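/- Let $Q$ be a generalized quantifier of type $\langle k\rangle$, that is, a class of structures $(M,A)$ with $A\subseteq M^k$, and write $Q_M=\{A\subseteq M^k : (M,A)\in Q\}$. Assume that $Q$ is monotone: if $A\subseteq B\subseteq M^k$ and $A\in Q_M$, then $B\in Q_M$. No non-triviality is assumed: $Q_M$ may be empty or contain $\emptyset$ for some or all universes $M$. Let $Q^d=\{(M,M^k\setminus A) : A\subseteq M^k,\ (M,A)\notin Q\}$ be the dual of $Q$. The following logics are considered over an arbitrary vocabulary $\tau$ and (non-empty) $\tau$-structures $\mathbb M$ with universe $M$. * $\mathrm{FO}(Q)$ is first-order logic (with equality and unrestricted negation) extended by the quantifier $Q$, where $\mathbb M,s\models Q\bar x\,\varphi$ iff $\{\bar a\in M^k : \mathbb M,s[\bar a/\bar x]\models\varphi\}\in Q_M$. * The formulas of $\mathrm{ESO}(Q,Q^d)$ are built from atomic and negated atomic formulas by $\wedge$, $\vee$, first-order $\exists$ and $\forall$, the quantifiers $Q$ and $Q^d$ (with the semantics above), and existential quantification of relations and of functions of any arity. * The formulas of $\mathrm D(Q,Q^d)$ are built from atomic and negated atomic formulas, dependence atoms $D(t_1,\dots,t_{m+1})$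 and negated dependence atoms by $\wedge$, $\vee$, $\exists$, $\forall$, $Q$ and $Q^d$. They are interpreted in teams $X$, that is, sets of assignments with a common finite domain of variables: $X$ satisfies a first-order atomic or negated atomic formula iff every $s\in X$ does; $X$ satisfies $D(t_1,\dots,t_{m+1})$ iff any two $s,s'\in X$ which agree on the values of $t_1,\dots,t_m$ agree on the value of $t_{m+1}$; $X$ satisfies a negated dependence atom iff $X=\emptyset$; $X$ satisfies $\varphi\wedge\psi$ iff it satisfies both; $X$ satisfies $\varphi\vee\psi$ iff $X=Y\cup Z$ for some teams $Y$ satisfying $\varphi$ and $Z$ satisfying $\psi$; $X$ satisfies $\exists y\,\varphi$ iff $\{s[f(s)/y] : s\in X\}$ satisfies $\varphi$ for some $f\colon X\to M$; $X$ satisfies $\forall y\,\varphi$ iff $\{s[a/y] : s\in X,\ a\in M\}$ satisfies $\varphi$; and, for $P\in\{Q,Q^d\}$, $X$ satisfies $P\bar x\,\varphi$ iff there is $F\colon X\to P_M$ such that $\{s[\bar a/\bar x] : s\in X,\ \bar a\in F(s)\}$ satisfies $\varphi$. A sentence is true in $\mathbb M$ iff it is satisfied by the team whose only member is the empty assignment.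 Then $\mathrm{ESO}(Q,Q^d)\equiv\mathrm D(Q,Q^d)$: for every vocabulary $\tau$, every $\tau$-sentence of $\mathrm{ESO}(Q,Q^d)$ is true in exactly the same $\tau$-structures as some $\tau$-sentence of $\mathrm D(Q,Q^d)$, and conversely. Moreover $\mathrm{FO}(Q)\le\mathrm D(Q,Q^d)$: every $\tau$-sentence of $\mathrm{FO}(Q)$ is true in exactly the same $\tau$-structures as some $\tau$-sentence of $\mathrm D(Q,Q^d)$. -/

import Mathlib

universe u v w

namespace TeamLogic

/-! ### Generalized quantifiers -/

/-- A generalized quantifier of type `⟨k⟩`: a class of structures `(M, A)` with `A ⊆ M ^ k`,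
given by the families `Q M = {A | (M, A) ∈ Q}`. -/
def GenQuantifier (k : ℕ) : Type (u + 1) :=
  ∀ M : Type u, Set (Set (Fin k → M))

/-- `Q` is monotone (increasing). -/
def GenQuantifier.Mono {k : ℕ} (Q : GenQuantifier.{u} k) : Prop :=
  ∀ (M : Type u) (A B : Set (Fin k → M)), A ⊆ B → A ∈ Q M → B ∈ Q M

/-- The dual quantifier `{(M, Aᶜ) | (M, A) ∉ Q}`. -/
def GenQuantifier.dual {k : ℕ} (Q : GenQuantifier.{u} k) : GenQuantifier.{u} k :=
  fun M => {B | ∃ A : Set (Fin k → M), A ∉ Q M ∧ B = Aᶜ}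

/-! ### Atomic first-order formulas

In all logics below the formulas are well scoped: `n` is the number of variables in scope, and a
quantifier binds fresh variables, which are put after the `n` old ones. Sentences have `n = 0`. -/

/-- Atomic first-order formulas of the vocabulary `L` in the variables `x_0, …, x_{n-1}`. -/
inductive Atom (L : FirstOrder.Language.{v, w}) (n : ℕ) : Type (max v w)
  | eq (t₁ t₂ : L.Term (Fin n)) : Atom L n
  | rel {m : ℕ} (R : L.Relations m) (ts : Fin m → L.Term (Fin n)) : Atom L n

/-- Truth of an atomic formula under a single assignment. -/
def Atom.Holds {L : FirstOrder.Language.{v, w}} {n : ℕ} {M : Type u} (S : L.Structure M) :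
    Atom L n → (Fin n → M) → Prop
  | .eq t₁ t₂, s => t₁.realize s = t₂.realize s
  | .rel R ts, s => FirstOrder.Language.Structure.RelMap R (fun i => (ts i).realize s)

/-! ### First-order logic with generalized quantifiers -/

/-- Formulas of `FO(Q_i : i ∈ ι)`, all `Q_i` being of type `⟨k⟩`; negation is unrestricted. -/
inductive FOFormula (k : ℕ) (ι : Type) (L : FirstOrder.Language.{v, w}) : ℕ → Type (max v w)
  | atom {n : ℕ} (a : Atom L n) : FOFormula k ι L n
  | neg {n : ℕ} (φ : FOFormula k ι L n) : FOFormula k ι L n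
  | and {n : ℕ} (φ ψ : FOFormula k ι L n) : FOFormula k ι L n
  | or {n : ℕ} (φ ψ : FOFormula k ι L n) : FOFormula k ι L n
  | ex {n : ℕ} (φ : FOFormula k ι L (n + 1)) : FOFormula k ι L n
  | all {n : ℕ} (φ : FOFormula k ι L (n + 1)) : FOFormula k ι L n
  | quant {n : ℕ} (i : ι) (φ : FOFormula k ι L (n + k)) : FOFormula k ι L n

/-- Tarskian satisfaction for `FO(Q_i : i ∈ ι)`. -/
def FOFormula.Sat {k : ℕ} {ι : Type} (Q : ι → GenQuantifier.{u} k) {L : FirstOrder.Language.{v, w}}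
    {M : Type u} (S : L.Structure M) : {n : ℕ} → FOFormula k ι L n → (Fin n → M) → Prop
  | _, .atom a, s => a.Holds S s
  | _, .neg φ, s => ¬ φ.Sat Q S s
  | _, .and φ ψ, s => φ.Sat Q S s ∧ ψ.Sat Q S s
  | _, .or φ ψ, s => φ.Sat Q S s ∨ ψ.Sat Q S s
  | _, .ex φ, s => ∃ a : M, φ.Sat Q S (Fin.snoc s a)
  | _, .all φ, s => ∀ a : M, φ.Sat Q S (Fin.snoc s a)
  | _, .quant i φ, s => {a : Fin k → M | φ.Sat Q S (Fin.append s a)} ∈ Q i M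

/-- Truth of a sentence of `FO(Q_i : i ∈ ι)` in the structure `M`. -/
def FOFormula.TrueIn {k : ℕ} {ι : Type} (Q : ι → GenQuantifier.{u} k) {L : FirstOrder.Language.{v, w}}
    (φ : FOFormula k ι L 0) (M : Type u) [S : L.Structure M] : Prop :=
  φ.Sat Q S (Fin.elim0 : Fin 0 → M)

/-! ### Existential second-order logic with generalized quantifiers -/

/-- The family of symbol types with exactly one symbol, which has arity `m`. -/
inductive OneSym (m : ℕ) : ℕ → Type
  | sym : OneSym m m

/-- The vocabulary with a single function symbol, of arity `m`. -/
def funVar (m : ℕ) : FirstOrder.Language.{0, 0} := ⟨OneSym m, fun _ => Empty⟩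

/-- The vocabulary with a single relation symbol, of arity `m`. -/
def relVar (m : ℕ) : FirstOrder.Language.{0, 0} := ⟨fun _ => Empty, OneSym m⟩

/-- The expansion of `S` that interprets one new function symbol by `f`. -/
abbrev expandFun {L : FirstOrder.Language.{v, w}} {M : Type u} (S : L.Structure M) {m : ℕ}
    (f : (Fin m → M) → M) : (L.sum (funVar m)).Structure M :=
  letI : (funVar m).Structure M :=
    { funMap := fun g => match g with
        | .sym => f
      RelMap := fun r => nomatch r }
  L.sumStructure (funVar m) M

/-- The expansion of `S` that interprets one new relation symbol by `R`. -/
abbrev expandRel {L : FirstOrder.Language.{v, w}} {M : Type u} (S : L.Structure M) {m : ℕ}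
    (R : (Fin m → M) → Prop) : (L.sum (relVar m)).Structure M :=
  letI : (relVar m).Structure M :=
    { funMap := fun g => nomatch g
      RelMap := fun r => match r with
        | .sym => R }
  L.sumStructure (relVar m) M

/-- Formulas of `ESO(Q_i : i ∈ ι)`, all `Q_i` being of type `⟨k⟩`. A bound second-order variable
is a symbol that is added to the vocabulary. -/
inductive ESOFormula (k : ℕ) (ι : Type) :
    FirstOrder.Language.{v, w} → ℕ → Type (max (v + 1) (w + 1))
  | atom {L : FirstOrder.Language.{v, w}} {n : ℕ} (a : Atom L n) : ESOFormula k ι L n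
  | natom {L : FirstOrder.Language.{v, w}} {n : ℕ} (a : Atom L n) : ESOFormula k ι L n
  | and {L : FirstOrder.Language.{v, w}} {n : ℕ} (φ ψ : ESOFormula k ι L n) : ESOFormula k ι L n
  | or {L : FirstOrder.Language.{v, w}} {n : ℕ} (φ ψ : ESOFormula k ι L n) : ESOFormula k ι L n
  | ex {L : FirstOrder.Language.{v, w}} {n : ℕ} (φ : ESOFormula k ι L (n + 1)) : ESOFormula k ι L n
  | all {L : FirstOrder.Language.{v, w}} {n : ℕ} (φ : ESOFormula k ι L (n + 1)) : ESOFormula k ι L n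
  | quant {L : FirstOrder.Language.{v, w}} {n : ℕ} (i : ι) (φ : ESOFormula k ι L (n + k)) :
      ESOFormula k ι L n
  | exFun {L : FirstOrder.Language.{v, w}} {n : ℕ} (m : ℕ) (φ : ESOFormula k ι (L.sum (funVar m)) n) :
      ESOFormula k ι L n
  | exRel {L : FirstOrder.Language.{v, w}} {n : ℕ} (m : ℕ) (φ : ESOFormula k ι (L.sum (relVar m)) n) :
      ESOFormula k ι L n

/-- Tarskian satisfaction for `ESO(Q_i : i ∈ ι)` (full second-order semantics). -/
def ESOFormula.Sat {k : ℕ} {ι : Type} (Q : ι → GenQuantifier.{u} k) {M : Type u} :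
    {L : FirstOrder.Language.{v, w}} → {n : ℕ} → ESOFormula k ι L n → L.Structure M → (Fin n → M) → Prop
  | _, _, .atom a, S, s => a.Holds S s
  | _, _, .natom a, S, s => ¬ a.Holds S s
  | _, _, .and φ ψ, S, s => φ.Sat Q S s ∧ ψ.Sat Q S s
  | _, _, .or φ ψ, S, s => φ.Sat Q S s ∨ ψ.Sat Q S s
  | _, _, .ex φ, S, s => ∃ a : M, φ.Sat Q S (Fin.snoc s a)
  | _, _, .all φ, S, s => ∀ a : M, φ.Sat Q S (Fin.snoc s a)
  | _, _, .quant i φ, S, s => {a : Fin k → M | φ.Sat Q S (Fin.append s a)} ∈ Q i M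
  | _, _, .exFun m φ, S, s => ∃ f : (Fin m → M) → M, φ.Sat Q (expandFun S f) s
  | _, _, .exRel m φ, S, s => ∃ R : (Fin m → M) → Prop, φ.Sat Q (expandRel S R) s

/-- Truth of a sentence of `ESO(Q_i : i ∈ ι)` in the structure `M`. -/
def ESOFormula.TrueIn {k : ℕ} {ι : Type} (Q : ι → GenQuantifier.{u} k) {L : FirstOrder.Language.{v, w}}
    (φ : ESOFormula k ι L 0) (M : Type u) [S : L.Structure M] : Prop :=
  φ.Sat Q S (Fin.elim0 : Fin 0 → M)

/-! ### Dependence logic with generalized quantifiers -/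

/-- Formulas of `D(Q_i : i ∈ ι)`, all `Q_i` being of type `⟨k⟩`, in negation normal form.
`dep ts t` is the dependence atom `D(ts, t)`, and `ndep ts t` is its negation. -/
inductive DFormula (k : ℕ) (ι : Type) (L : FirstOrder.Language.{v, w}) : ℕ → Type (max v w)
  | atom {n : ℕ} (a : Atom L n) : DFormula k ι L n
  | natom {n : ℕ} (a : Atom L n) : DFormula k ι L n
  | dep {n m : ℕ} (ts : Fin m → L.Term (Fin n)) (t : L.Term (Fin n)) : DFormula k ι L n
  | ndep {n m : ℕ} (ts : Fin m → L.Term (Fin n)) (t : L.Term (Fin n)) : DFormula k ι L n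
  | and {n : ℕ} (φ ψ : DFormula k ι L n) : DFormula k ι L n
  | or {n : ℕ} (φ ψ : DFormula k ι L n) : DFormula k ι L n
  | ex {n : ℕ} (φ : DFormula k ι L (n + 1)) : DFormula k ι L n
  | all {n : ℕ} (φ : DFormula k ι L (n + 1)) : DFormula k ι L n
  | quant {n : ℕ} (i : ι) (φ : DFormula k ι L (n + k)) : DFormula k ι L n

/-- The team `X[f/y]`, where `y` is a fresh variable. -/
def teamEx {n : ℕ} {M : Type u} (X : Set (Fin n → M)) (f : X → M) : Set (Fin (n + 1) → M) :=
  {s' | ∃ s : X, s' = Fin.snoc s.1 (f s)}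

/-- The team `X[M/y]`, where `y` is a fresh variable. -/
def teamAll {n : ℕ} {M : Type u} (X : Set (Fin n → M)) : Set (Fin (n + 1) → M) :=
  {s' | ∃ s ∈ X, ∃ a : M, s' = Fin.snoc s a}

/-- The team `X[F/y_1 … y_k]`, where the `y_j` are fresh variables. -/
def teamQuant {n k : ℕ} {M : Type u} (X : Set (Fin n → M)) (F : X → Set (Fin k → M)) :
    Set (Fin (n + k) → M) :=
  {s' | ∃ s : X, ∃ a ∈ F s, s' = Fin.append s.1 a}

/-- Satisfaction of a formula of `D(Q_i : i ∈ ι)` by a team. -/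
def DFormula.Sat {k : ℕ} {ι : Type} (Q : ι → GenQuantifier.{u} k) {L : FirstOrder.Language.{v, w}}
    {M : Type u} (S : L.Structure M) : {n : ℕ} → DFormula k ι L n → Set (Fin n → M) → Prop
  | _, .atom a, X => ∀ s ∈ X, a.Holds S s
  | _, .natom a, X => ∀ s ∈ X, ¬ a.Holds S s
  | _, .dep ts t, X => ∀ s ∈ X, ∀ s' ∈ X,
      (∀ i, (ts i).realize s = (ts i).realize s') → t.realize s = t.realize s'
  | _, .ndep _ _, X => X = ∅
  | _, .and φ ψ, X => φ.Sat Q S X ∧ ψ.Sat Q S X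
  | _, .or φ ψ, X => ∃ Y Z, X = Y ∪ Z ∧ φ.Sat Q S Y ∧ ψ.Sat Q S Z
  | _, .ex φ, X => ∃ f : X → M, φ.Sat Q S (teamEx X f)
  | _, .all φ, X => φ.Sat Q S (teamAll X)
  | _, .quant i φ, X => ∃ F : X → Set (Fin k → M),
      (∀ s, F s ∈ Q i M) ∧ φ.Sat Q S (teamQuant X F)

/-- Truth of a sentence of `D(Q_i : i ∈ ι)` in the structure `M`: the team whose only member is
the empty assignment satisfies it. -/
def DFormula.TrueIn {k : ℕ} {ι : Type} (Q : ι → GenQuantifier.{u} k) {L : FirstOrder.Language.{v, w}}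
    (φ : DFormula k ι L 0) (M : Type u) [S : L.Structure M] : Prop :=
  φ.Sat Q S {(Fin.elim0 : Fin 0 → M)}

end TeamLogic

namespace TeamLogic

/-! ### Tuples and atomic formulas -/

/-! From dependence logic to ESO: a team is a relation, so satisfaction of a formula by the team `R`
is an ESO condition on `R` (`DFormula.esoDef`). Downward closure lets each connective be evaluated
by guessing auxiliary teams subject to first-order inclusion conditions, so these teams become
existentially quantified relations.

From `FO(Q)` to ESO: this is negation normal form. The truth set of a negated formula is a
complement, and a complement lies in the dual exactly when the set itself is not in `Q`
(`FOFormula.esoDef`).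

From ESO to dependence logic there are two stages. First, second-order variables are replaced by
functions of one common arity `m`, each depending only on selected arguments. Relations become
equalizers of two functions, with the empty relation treated separately because it is no equalizer
over a one-element universe (`ESOFormula.codeDef`). Second, functions are represented by teams:
`graphTeam X f` contains, for each `s` in `X`, one row for every argument tuple `z`, holding the
values of the functions `f s` at `z`. By induction, each formula has a definable class of teams that
contains `graphTeam X f` exactly when every `s` in `X`, with its functions `f s`, satisfies the
formula (`FunFormula.flatDef`). For a sentence the functions are absent, and the graph team arises
by universally quantifying the arguments.

The difficulty in the second stage is that all rows of one `s` must be treated alike. Witnesses and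
function values are controlled by dependence atoms (`DDef.exKey`), and disjunctions are split
according to `s` only (`DDef.sep`). The sets chosen for `Q` cannot be controlled in this way and may
vary with `z`. In `FlatDef.quant` the whole function graph is therefore rebuilt inside the scope of
`Q` from fresh arguments, with values depending only on `s` and those arguments, and compared with
the old rows. Rows are lost only when the empty set is chosen, and then monotonicity makes every set
belong to the quantifier. -/

theorem forall_append_succ {n r : ℕ} {M : Type u} (s : Fin n → M)
    (A : (Fin (n + (r + 1)) → M) → Prop) :
    (∀ a : Fin (r + 1) → M, A (Fin.append s a)) ↔
      ∀ (a : Fin r → M) (b : M), A (Fin.snoc (Fin.append s a) b) := by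
  constructor
  · intro h a b
    rw [← Fin.append_snoc]
    exact h _
  · intro h a
    rw [← Fin.snoc_init_self a, Fin.append_snoc]
    exact h _ _

theorem exists_append_succ {n r : ℕ} {M : Type u} (s : Fin n → M)
    (A : (Fin (n + (r + 1)) → M) → Prop) :
    (∃ a : Fin (r + 1) → M, A (Fin.append s a)) ↔
      ∃ (a : Fin r → M) (b : M), A (Fin.snoc (Fin.append s a) b) := by
  have := forall_append_succ s (fun x => ¬ A x)
  simpa using not_congr this

theorem append_fin_zero {n : ℕ} {M : Type u} (s : Fin n → M) (a : Fin 0 → M) :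
    Fin.append s a = s := by
  rw [Fin.append_right_nil _ _ rfl]
  rfl

theorem forall_append_zero {n : ℕ} {M : Type u} (s : Fin n → M) (A : (Fin n → M) → Prop) :
    (∀ a : Fin 0 → M, A (Fin.append s a)) ↔ A s := by
  constructor
  · intro h
    simpa only [append_fin_zero] using h Fin.elim0
  · intro h a
    simpa only [append_fin_zero] using h

theorem exists_append_zero {n : ℕ} {M : Type u} (s : Fin n → M) (A : (Fin n → M) → Prop) :
    (∃ a : Fin 0 → M, A (Fin.append s a)) ↔ A s := by
  simpa using not_congr (forall_append_zero s (fun x => ¬ A x))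

theorem append_comp_castAdd {n r : ℕ} {M : Type u} (s : Fin n → M) (a : Fin r → M) :
    Fin.append s a ∘ Fin.castAdd r = s := by
  ext i; simp

theorem append_comp_natAdd {n r : ℕ} {M : Type u} (s : Fin n → M) (a : Fin r → M) :
    Fin.append s a ∘ Fin.natAdd n = a := by
  ext i; simp

theorem append_inj {n r : ℕ} {M : Type u} {s s' : Fin n → M} {a a' : Fin r → M}
    (h : Fin.append s a = Fin.append s' a') : s = s' ∧ a = a' :=
  ⟨by rw [← append_comp_castAdd s a, h, append_comp_castAdd],
    by rw [← append_comp_natAdd s a, h, append_comp_natAdd]⟩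

theorem snoc_comp_castSucc_eq {n : ℕ} {M : Type u} (s : Fin n → M) (a : M) :
    (Fin.snoc s a : Fin (n + 1) → M) ∘ Fin.castSucc = s := by
  ext i; simp

/-- Renaming of variables in an atomic formula. -/
def Atom.relabel {L : FirstOrder.Language.{v, w}} {n n' : ℕ} (ρ : Fin n → Fin n') : Atom L n → Atom L n'
  | .eq t₁ t₂ => .eq (t₁.relabel ρ) (t₂.relabel ρ)
  | .rel R ts => .rel R (fun i => (ts i).relabel ρ)

theorem Atom.holds_relabel {L : FirstOrder.Language.{v, w}} {n n' : ℕ} (ρ : Fin n → Fin n') {M : Type u}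
    (S : L.Structure M) (a : Atom L n) (s : Fin n' → M) :
    (a.relabel ρ).Holds S s ↔ a.Holds S (s ∘ ρ) := by
  cases a <;> simp [Atom.relabel, Atom.Holds, FirstOrder.Language.Term.realize_relabel]

/-- The image of an atomic formula under a language homomorphism. -/
def Atom.onLang {L L' : FirstOrder.Language.{v, w}} {n : ℕ} (h : L →ᴸ L') : Atom L n → Atom L' n
  | .eq t₁ t₂ => .eq (h.onTerm t₁) (h.onTerm t₂)
  | .rel R ts => .rel (h.onRelation R) (fun i => h.onTerm (ts i))

theorem realize_onTerm_reduct {L L' : FirstOrder.Language.{v, w}} {α : Type*} (h : L →ᴸ L') {M : Type u}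
    (S : L'.Structure M) (t : L.Term α) (s : α → M) :
    (h.onTerm t).realize s = @FirstOrder.Language.Term.realize L M (h.reduct M) α s t := by
  let _ := h.reduct M
  exact FirstOrder.Language.LHom.realize_onTerm h t s

theorem Atom.holds_onLang {L L' : FirstOrder.Language.{v, w}} {n : ℕ} (h : L →ᴸ L') {M : Type u}
    (S : L'.Structure M) (a : Atom L n) (s : Fin n → M) :
    (a.onLang h).Holds S s ↔ a.Holds (h.reduct M) s := by
  cases a with
  | eq t₁ t₂ => simp only [Atom.onLang, Atom.Holds, realize_onTerm_reduct]
  | rel R ts =>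
    simp only [Atom.onLang, Atom.Holds, realize_onTerm_reduct]
    rfl

/-! ### Downward closure -/

theorem DFormula.Sat.mono {k : ℕ} {ι : Type} {Q : ι → GenQuantifier.{u} k}
    {L : FirstOrder.Language.{v, w}} {M : Type u} {S : L.Structure M} {n : ℕ} {φ : DFormula k ι L n} :
    ∀ {X Y : Set (Fin n → M)}, X ⊆ Y → φ.Sat Q S Y → φ.Sat Q S X := by
  induction φ with
  | atom a => exact fun h hY s hs => hY s (h hs)
  | natom a => exact fun h hY s hs => hY s (h hs)
  | dep ts t => exact fun h hY s hs s' hs' => hY s (h hs) s' (h hs')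
  | ndep ts t =>
    intro X Y h hY
    have hY' : Y = ∅ := hY
    exact Set.subset_eq_empty h hY'
  | and φ ψ ih₁ ih₂ => exact fun h hY => ⟨ih₁ h hY.1, ih₂ h hY.2⟩
  | or φ ψ ih₁ ih₂ =>
    rintro X Y h ⟨Y₁, Y₂, rfl, h₁, h₂⟩
    refine ⟨X ∩ Y₁, X ∩ Y₂, ?_, ih₁ Set.inter_subset_right h₁, ih₂ Set.inter_subset_right h₂⟩
    rw [← Set.inter_union_distrib_left, Set.inter_eq_left.2 h]
  | ex φ ih =>
    rintro X Y h ⟨f, hf⟩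
    refine ⟨fun s => f ⟨s.1, h s.2⟩, ih ?_ hf⟩
    rintro _ ⟨s, rfl⟩
    exact ⟨⟨s.1, h s.2⟩, rfl⟩
  | all φ ih =>
    intro X Y h hY
    refine ih ?_ hY
    rintro _ ⟨s, hs, a, rfl⟩
    exact ⟨s, h hs, a, rfl⟩
  | quant i φ ih =>
    rintro X Y h ⟨F, hF, hφ⟩
    refine ⟨fun s => F ⟨s.1, h s.2⟩, fun s => hF _, ih ?_ hφ⟩
    rintro _ ⟨s, a, ha, rfl⟩
    exact ⟨⟨s.1, h s.2⟩, a, ha, rfl⟩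

/-- Disjunction may be evaluated with a cover instead of a partition into a union. -/
theorem DFormula.sat_or_iff {k : ℕ} {ι : Type} {Q : ι → GenQuantifier.{u} k}
    {L : FirstOrder.Language.{v, w}} {M : Type u} {S : L.Structure M} {n : ℕ} {φ ψ : DFormula k ι L n}
    {X : Set (Fin n → M)} :
    (DFormula.or φ ψ).Sat Q S X ↔ ∃ Y Z, X ⊆ Y ∪ Z ∧ φ.Sat Q S Y ∧ ψ.Sat Q S Z := by
  constructor
  · rintro ⟨Y, Z, h, h₁, h₂⟩
    exact ⟨Y, Z, h.le, h₁, h₂⟩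
  · rintro ⟨Y, Z, h, h₁, h₂⟩
    refine ⟨X ∩ Y, X ∩ Z, ?_, h₁.mono Set.inter_subset_right, h₂.mono Set.inter_subset_right⟩
    rw [← Set.inter_union_distrib_left, Set.inter_eq_left.2 h]

/-- Existential quantification may be evaluated with nonempty sets of witnesses. -/
theorem DFormula.sat_ex_iff {k : ℕ} {ι : Type} {Q : ι → GenQuantifier.{u} k}
    {L : FirstOrder.Language.{v, w}} {M : Type u} {S : L.Structure M} {n : ℕ} {φ : DFormula k ι L (n + 1)}
    {X : Set (Fin n → M)} :
    (DFormula.ex φ).Sat Q S X ↔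
      ∃ X', (∀ s ∈ X, ∃ a, Fin.snoc s a ∈ X') ∧ φ.Sat Q S X' := by
  constructor
  · rintro ⟨f, hf⟩
    exact ⟨teamEx X f, fun s hs => ⟨f ⟨s, hs⟩, ⟨s, hs⟩, rfl⟩, hf⟩
  · rintro ⟨X', hX', h⟩
    choose f hf using hX'
    refine ⟨fun s => f s.1 s.2, h.mono ?_⟩
    rintro _ ⟨s, rfl⟩
    exact hf _ s.2

theorem DFormula.sat_all_iff {k : ℕ} {ι : Type} {Q : ι → GenQuantifier.{u} k}
    {L : FirstOrder.Language.{v, w}} {M : Type u} {S : L.Structure M} {n : ℕ} {φ : DFormula k ι L (n + 1)}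
    {X : Set (Fin n → M)} :
    (DFormula.all φ).Sat Q S X ↔ ∃ X', (∀ s ∈ X, ∀ a, Fin.snoc s a ∈ X') ∧ φ.Sat Q S X' := by
  constructor
  · intro h
    exact ⟨teamAll X, fun s hs a => ⟨s, hs, a, rfl⟩, h⟩
  · rintro ⟨X', hX', h⟩
    refine h.mono ?_
    rintro _ ⟨s, hs, a, rfl⟩
    exact hX' s hs a

/-- A generalized quantifier is evaluated by an extension of the team with sections in it. -/
theorem DFormula.sat_quant_iff {k : ℕ} {ι : Type} {Q : ι → GenQuantifier.{u} k}
    {L : FirstOrder.Language.{v, w}} {M : Type u} {S : L.Structure M} {n : ℕ} {i : ι}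
    {φ : DFormula k ι L (n + k)} {X : Set (Fin n → M)} :
    (DFormula.quant i φ).Sat Q S X ↔
      ∃ X', (∀ s ∈ X, {a | Fin.append s a ∈ X'} ∈ Q i M) ∧ φ.Sat Q S X' := by
  constructor
  · rintro ⟨F, hF, h⟩
    refine ⟨_, fun s hs => ?_, h⟩
    -- Fresh variables keep the extensions of distinct assignments apart, so the section is exactly
    -- `F s` and no monotonicity is needed.
    convert hF ⟨s, hs⟩ using 1
    ext a
    constructor
    · rintro ⟨⟨s', hs'⟩, b, hb, e⟩
      obtain ⟨rfl, rfl⟩ := append_inj e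
      exact hb
    · intro ha
      exact ⟨⟨s, hs⟩, a, ha, rfl⟩
  · rintro ⟨X', hX', h⟩
    refine ⟨fun s => {a | Fin.append s.1 a ∈ X'}, fun s => hX' _ s.2, h.mono ?_⟩
    rintro _ ⟨s, a, ha, rfl⟩
    exact ha

/-! ### Definability in existential second-order logic -/

/-- Definability of a class of pointed structures by a formula of `ESO(Q_i : i ∈ ι)`. -/
def ESODef {k : ℕ} {ι : Type} (Q : ι → GenQuantifier.{u} k) (L : FirstOrder.Language.{v, w}) (n : ℕ)
    (A : ∀ M : Type u, L.Structure M → (Fin n → M) → Prop) : Prop :=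
  ∃ φ : ESOFormula k ι L n, ∀ (M : Type u) (S : L.Structure M) (s : Fin n → M),
    φ.Sat Q S s ↔ A M S s

section ESODef

variable {k : ℕ} {ι : Type} {Q : ι → GenQuantifier.{u} k} {L : FirstOrder.Language.{v, w}} {n : ℕ}
  {A B : ∀ M : Type u, L.Structure M → (Fin n → M) → Prop}

theorem ESODef.atom (a : Atom L n) : ESODef Q L n (fun _ S s => a.Holds S s) :=
  ⟨.atom a, fun _ _ _ => Iff.rfl⟩

theorem ESODef.natom (a : Atom L n) : ESODef Q L n (fun _ S s => ¬ a.Holds S s) :=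
  ⟨.natom a, fun _ _ _ => Iff.rfl⟩

theorem ESODef.congr (hA : ESODef Q L n A) (h : ∀ M S s, A M S s ↔ B M S s) : ESODef Q L n B :=
  let ⟨φ, hφ⟩ := hA
  ⟨φ, fun M S s => (hφ M S s).trans (h M S s)⟩

theorem ESODef.and (hA : ESODef Q L n A) (hB : ESODef Q L n B) :
    ESODef Q L n (fun M S s => A M S s ∧ B M S s) :=
  let ⟨φ, hφ⟩ := hA
  let ⟨ψ, hψ⟩ := hB
  ⟨.and φ ψ, fun M S s => and_congr (hφ M S s) (hψ M S s)⟩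

theorem ESODef.or (hA : ESODef Q L n A) (hB : ESODef Q L n B) :
    ESODef Q L n (fun M S s => A M S s ∨ B M S s) :=
  let ⟨φ, hφ⟩ := hA
  let ⟨ψ, hψ⟩ := hB
  ⟨.or φ ψ, fun M S s => or_congr (hφ M S s) (hψ M S s)⟩

theorem ESODef.ex {A : ∀ M : Type u, L.Structure M → (Fin (n + 1) → M) → Prop}
    (hA : ESODef Q L (n + 1) A) : ESODef Q L n (fun M S s => ∃ a, A M S (Fin.snoc s a)) :=
  let ⟨φ, hφ⟩ := hA
  ⟨.ex φ, fun M S _ => exists_congr fun _ => hφ M S _⟩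

theorem ESODef.all {A : ∀ M : Type u, L.Structure M → (Fin (n + 1) → M) → Prop}
    (hA : ESODef Q L (n + 1) A) : ESODef Q L n (fun M S s => ∀ a, A M S (Fin.snoc s a)) :=
  let ⟨φ, hφ⟩ := hA
  ⟨.all φ, fun M S _ => forall_congr' fun _ => hφ M S _⟩

theorem ESODef.quant {A : ∀ M : Type u, L.Structure M → (Fin (n + k) → M) → Prop} (i : ι)
    (hA : ESODef Q L (n + k) A) :
    ESODef Q L n (fun M S s => {a : Fin k → M | A M S (Fin.append s a)} ∈ Q i M) := by
  obtain ⟨φ, hφ⟩ := hA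
  refine ⟨.quant i φ, fun M S s => ?_⟩
  simp only [ESOFormula.Sat, hφ]

theorem ESODef.exRel {m : ℕ}
    {A : ∀ M : Type u, (L.sum (relVar m)).Structure M → (Fin n → M) → Prop}
    (hA : ESODef Q (L.sum (relVar m)) n A) :
    ESODef Q L n (fun M S s => ∃ R : (Fin m → M) → Prop, A M (expandRel S R) s) :=
  let ⟨φ, hφ⟩ := hA
  ⟨.exRel m φ, fun M _ _ => exists_congr fun _ => hφ M _ _⟩

theorem ESODef.alls : ∀ {r : ℕ} {A : ∀ M : Type u, L.Structure M → (Fin (n + r) → M) → Prop},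
    ESODef Q L (n + r) A →
      ESODef Q L n (fun M S s => ∀ a : Fin r → M, A M S (Fin.append s a))
  | 0, _, hA => ESODef.congr hA fun _ _ _ => (forall_append_zero _ _).symm
  | _ + 1, _, hA => (ESODef.alls (ESODef.all hA)).congr fun _ _ _ =>
      (forall_append_succ _ _).symm

/-- The extra disjunct `B` is the value of the recursion at `m = 0`, so no formula for falsity is
required. -/
theorem ESODef.or_existsFin {B : ∀ M : Type u, L.Structure M → (Fin n → M) → Prop}
    (hB : ESODef Q L n B) :
    ∀ {m : ℕ} {A : Fin m → ∀ M : Type u, L.Structure M → (Fin n → M) → Prop},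
      (∀ j, ESODef Q L n (A j)) → ESODef Q L n (fun M S s => (∃ j, A j M S s) ∨ B M S s)
  | 0, _, _ => hB.congr fun _ _ _ => by simp
  | _ + 1, _, hA => ((hA 0).or (ESODef.or_existsFin hB fun j => hA j.succ)).congr
      fun _ _ _ => by rw [Fin.exists_fin_succ, or_assoc]

end ESODef

/-! ### Dependence logic in existential second-order logic -/

section Team

variable {k : ℕ} {ι : Type} {Q : ι → GenQuantifier.{u} k} {L : FirstOrder.Language.{v, w}} {n : ℕ}

/-- The atomic formula stating that the variables selected by `ρ` are in the relation `R`. -/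
def Atom.relOf {r : ℕ} (R : L.Relations r) (ρ : Fin r → Fin n) : Atom L n :=
  .rel R (fun i => .var (ρ i))

theorem Atom.holds_relOf {r : ℕ} (R : L.Relations r) (ρ : Fin r → Fin n) {M : Type u}
    (S : L.Structure M) (s : Fin n → M) :
    (Atom.relOf R ρ).Holds S s ↔ S.RelMap R (s ∘ ρ) := Iff.rfl

/-- The team that is the interpretation of a relation symbol. -/
def relTeam (R : L.Relations n) (M : Type u) (S : L.Structure M) : Set (Fin n → M) :=
  {s | S.RelMap R s}

/-- Universal quantification over a team given by a relation symbol. -/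
theorem ESODef.ballTeam {m : ℕ} (R : L.Relations n)
    {A : ∀ M : Type u, L.Structure M → (Fin n → M) → (Fin m → M) → Prop}
    (hA : ESODef Q L (m + n)
      (fun M S s => A M S (s ∘ Fin.natAdd m) (s ∘ Fin.castAdd n))) :
    ESODef Q L m (fun M S s' => ∀ s ∈ relTeam R M S, A M S s s') := by
  refine ((ESODef.natom (Atom.relOf R (Fin.natAdd m))).or hA).alls.congr fun M S s' => ?_
  refine forall_congr' fun s => ?_
  rw [Atom.holds_relOf, append_comp_natAdd, append_comp_castAdd, ← imp_iff_not_or]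
  rfl

theorem ESODef.exTeam {m : ℕ} {A : ∀ M : Type u, L.Structure M → Set (Fin m → M) → Prop}
    {B : ∀ M : Type u, (L.sum (relVar m)).Structure M → (Fin n → M) → Prop}
    (hB : ESODef Q (L.sum (relVar m)) n B)
    (h : ∀ M S s R, B M (expandRel S R) s ↔ A M S {x | R x}) :
    ESODef Q L n (fun M S _ => ∃ X : Set (Fin m → M), A M S X) :=
  hB.exRel.congr fun M S s => exists_congr fun R => h M S s R

theorem ESODef.mem {r : ℕ} (R : L.Relations r) (ρ : Fin r → Fin n) :
    ESODef Q L n (fun M S s => s ∘ ρ ∈ relTeam R M S) :=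
  ESODef.atom (Atom.relOf R ρ)

theorem comp_append {a b : ℕ} {V : Type} {M : Type u} (y : V → M) (f : Fin a → V)
    (g : Fin b → V) : y ∘ Fin.append f g = Fin.append (y ∘ f) (y ∘ g) := by
  ext i
  refine Fin.addCases (fun i => ?_) (fun i => ?_) i <;> simp

/-- The vocabulary `L'` and the symbol `R` are general because each connective adds symbols for the
guessed subteams or extended teams, to which the induction hypothesis is then applied. The formula
itself is still read in the reduct to `L`. -/
theorem DFormula.esoDef (ψ : DFormula k ι L n) :
    ∀ {L' : FirstOrder.Language.{v, w}} (h : L →ᴸ L') (R : L'.Relations n),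
      ESODef Q L' 0 (fun M S _ => ψ.Sat Q (h.reduct M) (relTeam R M S)) := by
  induction ψ with
  | atom a =>
    intro L' h R
    refine ((ESODef.atom ((a.onLang h).relabel (Fin.natAdd 0))).congr fun M S s =>
      ?_).ballTeam R (A := fun M S s _ => a.Holds (h.reduct M) s)
    rw [Atom.holds_relabel, Atom.holds_onLang]
  | natom a =>
    intro L' h R
    refine ((ESODef.natom ((a.onLang h).relabel (Fin.natAdd 0))).congr fun M S s =>
      ?_).ballTeam R (A := fun M S s _ => ¬ a.Holds (h.reduct M) s)
    rw [Atom.holds_relabel, Atom.holds_onLang]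
  | @dep n m ts t =>
    intro L' h R
    let eqn (t : L.Term (Fin n)) : Atom L' (0 + n + n) :=
      .eq ((h.onTerm t).relabel (Fin.natAdd (0 + n)))
        ((h.onTerm t).relabel (Fin.castAdd n ∘ Fin.natAdd 0))
    have holds_eqn (t : L.Term (Fin n)) (M : Type u) (S : L'.Structure M)
        (s : Fin (0 + n + n) → M) : (eqn t).Holds S s ↔
          @FirstOrder.Language.Term.realize L M (h.reduct M) _ (s ∘ Fin.natAdd (0 + n)) t =
            @FirstOrder.Language.Term.realize L M (h.reduct M) _
              ((s ∘ Fin.castAdd n) ∘ Fin.natAdd 0) t := by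
      simp only [eqn, Atom.Holds, FirstOrder.Language.Term.realize_relabel,
        realize_onTerm_reduct, Function.comp_assoc]
    refine ESODef.ballTeam R (A := fun M S s _ => ∀ s' ∈ relTeam R M S,
      (∀ i, @FirstOrder.Language.Term.realize L M (h.reduct M) _ s (ts i) =
        @FirstOrder.Language.Term.realize L M (h.reduct M) _ s' (ts i)) →
      @FirstOrder.Language.Term.realize L M (h.reduct M) _ s t =
        @FirstOrder.Language.Term.realize L M (h.reduct M) _ s' t)
      (ESODef.ballTeam R (A := fun M S s' s =>
      (∀ i, @FirstOrder.Language.Term.realize L M (h.reduct M) _ (s ∘ Fin.natAdd 0) (ts i) =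
        @FirstOrder.Language.Term.realize L M (h.reduct M) _ s' (ts i)) →
      @FirstOrder.Language.Term.realize L M (h.reduct M) _ (s ∘ Fin.natAdd 0) t =
        @FirstOrder.Language.Term.realize L M (h.reduct M) _ s' t) ?_)
    -- For a pair of assignments, the dependence implication is a disjunction of literals: some
    -- determining term differs, or the determined terms agree.
    refine ((ESODef.atom (eqn t)).or_existsFin fun i => ESODef.natom (eqn (ts i))).congr
      fun M S s => ?_
    simp only [holds_eqn, ← not_forall, ← imp_iff_not_or]
    simp only [eq_comm]
  | ndep ts t =>
    intro L' h R
    refine ((ESODef.natom (Atom.relOf R (Fin.natAdd 0))).alls).congr fun M S s => ?_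
    simp only [Atom.holds_relOf, append_comp_natAdd]
    exact Set.eq_empty_iff_forall_notMem.symm
  | and φ ψ ih₁ ih₂ => exact fun h R => (ih₁ h R).and (ih₂ h R)
  | @or n φ ψ ih₁ ih₂ =>
    intro L' h R
    simp only [DFormula.sat_or_iff]
    let L₁ := L'.sum (relVar n)
    let L₂ := L₁.sum (relVar n)
    let Y : L₂.Relations n := Sum.inl (Sum.inr OneSym.sym)
    let Z : L₂.Relations n := Sum.inr OneSym.sym
    let h₂ : L →ᴸ L₂ :=
      FirstOrder.Language.LHom.sumInl.comp (FirstOrder.Language.LHom.sumInl.comp h)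
    have hcover : ESODef Q L₂ 0 fun M S _ => ∀ s ∈ relTeam (Sum.inl (Sum.inl R)) M S,
        s ∈ relTeam Y M S ∨ s ∈ relTeam Z M S :=
      ESODef.ballTeam _ (A := fun M S s _ => s ∈ relTeam Y M S ∨ s ∈ relTeam Z M S)
        ((ESODef.mem Y _).or (ESODef.mem Z _))
    exact ESODef.exTeam (ESODef.exTeam (A := fun M S Z =>
      (∀ s ∈ relTeam (L := L₁) (Sum.inl R) M S,
        s ∈ relTeam (L := L₁) (Sum.inr OneSym.sym) M S ∨ s ∈ Z) ∧
      φ.Sat Q ((FirstOrder.Language.LHom.sumInl.comp h).reduct M)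
        (relTeam (L := L₁) (Sum.inr OneSym.sym) M S) ∧
      ψ.Sat Q ((FirstOrder.Language.LHom.sumInl.comp h).reduct M) Z)
      (hcover.and ((ih₁ h₂ Y).and (ih₂ h₂ Z))) fun M S s R => Iff.rfl) fun M S s R => Iff.rfl
  | @ex n φ ih =>
    intro L' h R
    simp only [DFormula.sat_ex_iff]
    refine ESODef.exTeam (ESODef.and (ESODef.ballTeam (Sum.inl R)
      (A := fun M S s _ => ∃ a, Fin.snoc s a ∈ relTeam (L := L'.sum (relVar (n + 1)))
        (Sum.inr OneSym.sym) M S) ?_)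
      (ih (FirstOrder.Language.LHom.sumInl.comp h) (Sum.inr OneSym.sym))) fun M S s R => Iff.rfl
    refine (ESODef.mem (L := L'.sum (relVar (n + 1))) (Sum.inr OneSym.sym)
      (Fin.snoc (Fin.castSucc ∘ Fin.natAdd 0) (Fin.last _))).ex.congr
      fun M S s => exists_congr fun a => ?_
    rw [Fin.comp_snoc, ← Function.comp_assoc, snoc_comp_castSucc_eq, Fin.snoc_last]
  | @all n φ ih =>
    intro L' h R
    simp only [DFormula.sat_all_iff]
    refine ESODef.exTeam (ESODef.and (ESODef.ballTeam (Sum.inl R)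
      (A := fun M S s _ => ∀ a, Fin.snoc s a ∈ relTeam (L := L'.sum (relVar (n + 1)))
        (Sum.inr OneSym.sym) M S) ?_)
      (ih (FirstOrder.Language.LHom.sumInl.comp h) (Sum.inr OneSym.sym))) fun M S s R => Iff.rfl
    refine (ESODef.mem (L := L'.sum (relVar (n + 1))) (Sum.inr OneSym.sym)
      (Fin.snoc (Fin.castSucc ∘ Fin.natAdd 0) (Fin.last _))).all.congr
      fun M S s => forall_congr' fun a => ?_
    rw [Fin.comp_snoc, ← Function.comp_assoc, snoc_comp_castSucc_eq, Fin.snoc_last]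
  | @quant n i φ ih =>
    intro L' h R
    simp only [DFormula.sat_quant_iff]
    refine ESODef.exTeam (ESODef.and (ESODef.ballTeam (Sum.inl R)
      (A := fun M S s _ => {a | Fin.append s a ∈ relTeam (L := L'.sum (relVar (n + k)))
        (Sum.inr OneSym.sym) M S} ∈ Q i M) ?_)
      (ih (FirstOrder.Language.LHom.sumInl.comp h) (Sum.inr OneSym.sym))) fun M S s R => Iff.rfl
    refine ((ESODef.mem (L := L'.sum (relVar (n + k))) (Sum.inr OneSym.sym)
      (Fin.append (Fin.castAdd k ∘ Fin.natAdd 0) (Fin.natAdd (0 + n)))).quant i).congr fun M S s => ?_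
    simp only [comp_append, ← Function.comp_assoc, append_comp_castAdd,
      append_comp_natAdd]

theorem DFormula.exists_esoFormula (ψ : DFormula k ι L 0) :
    ∃ φ : ESOFormula k ι L 0, ∀ (M : Type u) [L.Structure M], ψ.TrueIn Q M ↔ φ.TrueIn Q M := by
  let R : (L.sum (relVar 0)).Relations 0 := Sum.inr OneSym.sym
  -- It suffices to guess a nullary relation containing the empty tuple, since downward closure
  -- passes from it to the singleton team.
  obtain ⟨φ, hφ⟩ : ESODef Q L 0 fun M S _ => ∃ X : Set (Fin 0 → M),
      (Fin.elim0 : Fin 0 → M) ∈ X ∧ ψ.Sat Q S X :=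
    ESODef.exTeam (((ESODef.mem R id).congr (B := fun M S s => (Fin.elim0 : Fin 0 → M) ∈
      relTeam R M S) fun M S s => by rw [Subsingleton.elim (s ∘ id) Fin.elim0]).and
      (ψ.esoDef FirstOrder.Language.LHom.sumInl R)) fun M S s R => Iff.rfl
  refine ⟨φ, fun M S => ((hφ M S _).trans ⟨?_, ?_⟩).symm⟩
  · rintro ⟨X, hX, h⟩
    exact h.mono (Set.singleton_subset_iff.2 hX)
  · exact fun h => ⟨{Fin.elim0}, rfl, h⟩

end Team

/-! ### Negation normal form -/

theorem GenQuantifier.compl_mem_dual {k : ℕ} (Q : GenQuantifier.{u} k) {M : Type u}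
    (A : Set (Fin k → M)) : Aᶜ ∈ Q.dual M ↔ A ∉ Q M := by
  constructor
  · rintro ⟨B, hB, h⟩
    rwa [compl_injective h]
  · exact fun h => ⟨A, h, rfl⟩

theorem GenQuantifier.Mono.dual {k : ℕ} {Q : GenQuantifier.{u} k} (hQ : Q.Mono) :
    Q.dual.Mono := by
  intro M A B hAB hA
  rw [← compl_compl A, compl_mem_dual] at hA
  rw [← compl_compl B, compl_mem_dual]
  exact fun hB => hA (hQ M _ _ (Set.compl_subset_compl.2 hAB) hB)

/-- Treating a formula and its negation together lets negation swap the two halves. Index `0` of the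
vector is `Q` and index `1` its dual. -/
theorem FOFormula.esoDef {k : ℕ} (Q : GenQuantifier.{u} k) {L : FirstOrder.Language.{v, w}}
    {n : ℕ} (χ : FOFormula k (Fin 1) L n) :
    ESODef ![Q, Q.dual] L n (fun _ S s => χ.Sat ![Q] S s) ∧
      ESODef ![Q, Q.dual] L n (fun _ S s => ¬ χ.Sat ![Q] S s) := by
  induction χ with
  | atom a => exact ⟨.atom a, .natom a⟩
  | neg φ ih => exact ⟨ih.2, ih.1.congr fun _ _ _ => not_not.symm⟩
  | and φ ψ ih₁ ih₂ =>
    exact ⟨ih₁.1.and ih₂.1, (ih₁.2.or ih₂.2).congr fun _ _ _ => not_and_or.symm⟩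
  | or φ ψ ih₁ ih₂ =>
    exact ⟨ih₁.1.or ih₂.1, (ih₁.2.and ih₂.2).congr fun _ _ _ => not_or.symm⟩
  | ex φ ih => exact ⟨ih.1.ex, ih.2.all.congr fun _ _ _ => not_exists.symm⟩
  | all φ ih => exact ⟨ih.1.all, ih.2.ex.congr fun _ _ _ => not_forall.symm⟩
  | quant i φ ih =>
    obtain rfl := Subsingleton.elim i 0
    exact ⟨ih.1.quant 0, (ih.2.quant 1).congr fun M S s => Q.compl_mem_dual _⟩

/-! ### First-order formulas with quantified functions

Functions have a common arity `m`; a quantified function depends only on the arguments that are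
selected by a map `c : Fin r → Fin m`. -/

/-- First-order formulas with generalized quantifiers in `p` function variables of arity `m` and
`n` individual variables, with existential function quantification. -/
inductive FunFormula (k : ℕ) (ι : Type) (L : FirstOrder.Language.{v, w}) (m : ℕ) :
    ℕ → ℕ → Type (max v w)
  | lit {p n : ℕ} (a : Atom L n) : FunFormula k ι L m p n
  | nlit {p n : ℕ} (a : Atom L n) : FunFormula k ι L m p n
  | val {p n r : ℕ} (i : Fin p) (c : Fin r → Fin m) (x : Fin r → Fin n) (y : Fin n) :
      FunFormula k ι L m p n
  | and {p n : ℕ} (φ ψ : FunFormula k ι L m p n) : FunFormula k ι L m p n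
  | or {p n : ℕ} (φ ψ : FunFormula k ι L m p n) : FunFormula k ι L m p n
  | ex {p n : ℕ} (φ : FunFormula k ι L m p (n + 1)) : FunFormula k ι L m p n
  | all {p n : ℕ} (φ : FunFormula k ι L m p (n + 1)) : FunFormula k ι L m p n
  | quant {p n : ℕ} (i : ι) (φ : FunFormula k ι L m p (n + k)) : FunFormula k ι L m p n
  | exFun {p n r : ℕ} (c : Fin r → Fin m) (φ : FunFormula k ι L m (p + 1) n) :
      FunFormula k ι L m p n

/-- Tarskian satisfaction; `val i c x y` states that the `i`-th function takes the value `y`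
wherever its arguments selected by `c` are `x`. -/
def FunFormula.Sat {k : ℕ} {ι : Type} (Q : ι → GenQuantifier.{u} k)
    {L : FirstOrder.Language.{v, w}} {m : ℕ} {M : Type u} (S : L.Structure M) :
    {p n : ℕ} → FunFormula k ι L m p n → (Fin p → (Fin m → M) → M) → (Fin n → M) → Prop
  | _, _, .lit a, _, s => a.Holds S s
  | _, _, .nlit a, _, s => ¬ a.Holds S s
  | _, _, .val i c x y, f, s => ∀ z : Fin m → M, z ∘ c = s ∘ x → f i z = s y
  | _, _, .and φ ψ, f, s => φ.Sat Q S f s ∧ ψ.Sat Q S f s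
  | _, _, .or φ ψ, f, s => φ.Sat Q S f s ∨ ψ.Sat Q S f s
  | _, _, .ex φ, f, s => ∃ a : M, φ.Sat Q S f (Fin.snoc s a)
  | _, _, .all φ, f, s => ∀ a : M, φ.Sat Q S f (Fin.snoc s a)
  | _, _, .quant i φ, f, s => {a : Fin k → M | φ.Sat Q S f (Fin.append s a)} ∈ Q i M
  | _, _, @FunFormula.exFun _ _ _ _ _ _ r c φ, f, s =>
      ∃ g : (Fin r → M) → M, φ.Sat Q S (Fin.snoc f fun z => g (z ∘ c)) s

/-! ### Codings of symbols by functions -/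

/-- A coding of the symbols of `L'` by those of `L` and by `p` functions of arity `m`. A relation
is coded as the equalizer of two functions, or as the empty relation. -/
structure Coding (L L' : FirstOrder.Language.{v, w}) (m p : ℕ) where
  fn : ∀ {r : ℕ}, L'.Functions r → L.Functions r ⊕ Fin p × (Fin r ↪ Fin m)
  rl : ∀ {r : ℕ}, L'.Relations r → L.Relations r ⊕ Option (Fin p × Fin p × (Fin r ↪ Fin m))

/-- The interpretation `F` of a function symbol agrees with its code. -/
def FnCodes {L : FirstOrder.Language.{v, w}} {m p r : ℕ} {M : Type u} (S : L.Structure M)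
    (f : Fin p → (Fin m → M) → M) (F : (Fin r → M) → M) :
    L.Functions r ⊕ Fin p × (Fin r ↪ Fin m) → Prop
  | .inl g => ∀ a, F a = S.funMap g a
  | .inr (i, c) => ∀ z, f i z = F (z ∘ c)

/-- The interpretation `R` of a relation symbol agrees with its code. -/
def RelCodes {L : FirstOrder.Language.{v, w}} {m p r : ℕ} {M : Type u} (S : L.Structure M)
    (f : Fin p → (Fin m → M) → M) (R : (Fin r → M) → Prop) :
    L.Relations r ⊕ Option (Fin p × Fin p × (Fin r ↪ Fin m)) → Prop
  | .inl R' => ∀ a, R a ↔ S.RelMap R' a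
  | .inr none => ∀ a, ¬ R a
  | .inr (some (i, j, c)) => ∃ g₁ g₂ : (Fin r → M) → M, (∀ z, f i z = g₁ (z ∘ c)) ∧
      (∀ z, f j z = g₂ (z ∘ c)) ∧ ∀ a, R a ↔ g₁ a = g₂ a

/-- The structure `S'` is coded by the structure `S` and the functions `f`. -/
structure Coding.Models {L L' : FirstOrder.Language.{v, w}} {m p : ℕ} (C : Coding L L' m p)
    {M : Type u} (S : L.Structure M) (f : Fin p → (Fin m → M) → M) (S' : L'.Structure M) :
    Prop where
  fn : ∀ {r : ℕ} (g : L'.Functions r), FnCodes S f (S'.funMap g) (C.fn g)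
  rl : ∀ {r : ℕ} (R : L'.Relations r), RelCodes S f (S'.RelMap R) (C.rl R)

section Coding

variable {k : ℕ} {ι : Type} {Q : ι → GenQuantifier.{u} k} {L L' : FirstOrder.Language.{v, w}}
  {m p n : ℕ}

/-- Weakening of a code of a function symbol by one more function. -/
def liftFn {r : ℕ} : L.Functions r ⊕ Fin p × (Fin r ↪ Fin m) →
    L.Functions r ⊕ Fin (p + 1) × (Fin r ↪ Fin m) :=
  Sum.map id (Prod.map Fin.castSucc id)

/-- Weakening of a code of a relation symbol by one more function. -/
def liftRl {r : ℕ} : L.Relations r ⊕ Option (Fin p × Fin p × (Fin r ↪ Fin m)) →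
    L.Relations r ⊕ Option (Fin (p + 1) × Fin (p + 1) × (Fin r ↪ Fin m)) :=
  Sum.map id (Option.map (Prod.map Fin.castSucc (Prod.map Fin.castSucc id)))

theorem FnCodes.lift {r : ℕ} {M : Type u} {S : L.Structure M} {f : Fin p → (Fin m → M) → M}
    {F : (Fin r → M) → M} {c : L.Functions r ⊕ Fin p × (Fin r ↪ Fin m)} (h : FnCodes S f F c)
    (g : (Fin m → M) → M) : FnCodes S (Fin.snoc f g : Fin (p + 1) → _) F (liftFn c) := by
  rcases c with c | ⟨i, c⟩
  · exact h
  · simpa [liftFn, FnCodes] using h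

theorem RelCodes.lift {r : ℕ} {M : Type u} {S : L.Structure M} {f : Fin p → (Fin m → M) → M}
    {R : (Fin r → M) → Prop} {c : L.Relations r ⊕ Option (Fin p × Fin p × (Fin r ↪ Fin m))}
    (h : RelCodes S f R c) (g : (Fin m → M) → M) :
    RelCodes S (Fin.snoc f g : Fin (p + 1) → _) R (liftRl c) := by
  rcases c with c | _ | ⟨i, j, c⟩
  · exact h
  · exact h
  · simpa [liftRl, RelCodes] using h

/-- The coding that codes the symbols of the base language by themselves. -/
def Coding.refl (L : FirstOrder.Language.{v, w}) (m : ℕ) : Coding L L m 0 := ⟨.inl, .inl⟩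

theorem Coding.models_refl {M : Type u} (S : L.Structure M) (f : Fin 0 → (Fin m → M) → M) :
    (Coding.refl L m).Models S f S :=
  ⟨fun _ _ => rfl, fun _ _ => Iff.rfl⟩

/-- A coding of the expansion by a function symbol. -/
def Coding.addFun (C : Coding L L' m p) {r : ℕ} (c : Fin r ↪ Fin m) :
    Coding L (L'.sum (funVar r)) m (p + 1) where
  fn := fun g => match g with
    | .inl g => liftFn (C.fn g)
    | .inr .sym => .inr (Fin.last p, c)
  rl := fun R => match R with
    | .inl R => liftRl (C.rl R)

theorem Coding.Models.addFun {C : Coding L L' m p} {M : Type u} {S : L.Structure M}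
    {f : Fin p → (Fin m → M) → M} {S' : L'.Structure M} (h : C.Models S f S') {r : ℕ}
    (c : Fin r ↪ Fin m) (g : (Fin r → M) → M) :
    (C.addFun c).Models S (Fin.snoc f fun z => g (z ∘ c)) (expandFun S' g) where
  fn := fun g => match g with
    | .inl g => (h.fn g).lift _
    | .inr .sym => by
      intro z
      rw [Fin.snoc_last]
      rfl
  rl := fun R => match R with
    | .inl R => (h.rl R).lift _

/-- A coding of the expansion by a relation symbol that is the equalizer of two functions. -/
def Coding.addRel (C : Coding L L' m p) {r : ℕ} (c : Fin r ↪ Fin m) :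
    Coding L (L'.sum (relVar r)) m (p + 1 + 1) where
  fn := fun g => match g with
    | .inl g => liftFn (liftFn (C.fn g))
  rl := fun R => match R with
    | .inl R => liftRl (liftRl (C.rl R))
    | .inr .sym => .inr (some ((Fin.last p).castSucc, Fin.last (p + 1), c))

theorem Coding.Models.addRel {C : Coding L L' m p} {M : Type u} {S : L.Structure M}
    {f : Fin p → (Fin m → M) → M} {S' : L'.Structure M} (h : C.Models S f S') {r : ℕ}
    (c : Fin r ↪ Fin m) (g₁ g₂ : (Fin r → M) → M) :
    (C.addRel c).Models S (Fin.snoc (Fin.snoc f fun z => g₁ (z ∘ c) : Fin (p + 1) → _)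
      fun z => g₂ (z ∘ c)) (expandRel S' fun x => g₁ x = g₂ x) where
  fn := fun g => match g with
    | .inl g => ((h.fn g).lift _).lift _
  rl := fun R => match R with
    | .inl R => ((h.rl R).lift _).lift _
    | .inr .sym => by
      refine ⟨g₁, g₂, fun z => ?_, fun z => ?_, fun a => Iff.rfl⟩
      · rw [Fin.snoc_castSucc, Fin.snoc_last]
      · rw [Fin.snoc_last]

/-- A coding of the expansion by a symbol for the empty relation. -/
def Coding.addEmpty (C : Coding L L' m p) (r : ℕ) : Coding L (L'.sum (relVar r)) m p where
  fn := fun g => match g with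
    | .inl g => C.fn g
  rl := fun R => match R with
    | .inl R => C.rl R
    | .inr .sym => .inr none

theorem Coding.Models.addEmpty {C : Coding L L' m p} {M : Type u} {S : L.Structure M}
    {f : Fin p → (Fin m → M) → M} {S' : L'.Structure M} (h : C.Models S f S') (r : ℕ) :
    (C.addEmpty r).Models S f (expandRel S' fun _ => False) where
  fn := fun g => match g with
    | .inl g => h.fn g
  rl := fun R => match R with
    | .inl R => h.rl R
    | .inr .sym => fun _ h => h

/-- Injectivity of `c` rules out conflicting demands on a coordinate; the unselected coordinates get
an arbitrary element. Hence a function of arity `r` can be recovered from its padding to arity `m`.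
-/
theorem exists_comp_eq {M : Type u} [Nonempty M] {r : ℕ} (c : Fin r ↪ Fin m) (x : Fin r → M) :
    ∃ z : Fin m → M, z ∘ c = x :=
  ⟨Function.extend c x fun _ => Classical.arbitrary M, Function.extend_comp c.injective _ _⟩

theorem forall_comp_eq_iff {M : Type u} [Nonempty M] {r : ℕ} {c : Fin r ↪ Fin m}
    {f : (Fin m → M) → M} {g : (Fin r → M) → M} (h : ∀ z, f z = g (z ∘ c)) (x : Fin r → M)
    (y : M) : (∀ z : Fin m → M, z ∘ c = x → f z = y) ↔ g x = y := by
  constructor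
  · intro hf
    obtain ⟨z, rfl⟩ := exists_comp_eq c x
    rw [← h, hf z rfl]
  · rintro rfl z rfl
    exact h z

/-- Definability, relative to a coding, of a property of coded structures. -/
def CodeDef (Q : ι → GenQuantifier.{u} k) (C : Coding L L' m p) (n : ℕ)
    (A : ∀ M : Type u, L'.Structure M → (Fin n → M) → Prop) : Prop :=
  ∃ φ : FunFormula k ι L m p n, ∀ (M : Type u) [Nonempty M] (S : L.Structure M)
    (f : Fin p → (Fin m → M) → M) (S' : L'.Structure M), C.Models S f S' →
      ∀ s : Fin n → M, φ.Sat Q S f s ↔ A M S' s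

section CodeDef

variable {C : Coding L L' m p} {A B : ∀ M : Type u, L'.Structure M → (Fin n → M) → Prop}

theorem CodeDef.congr (hA : CodeDef Q C n A)
    (h : ∀ (M : Type u) [Nonempty M] S s, A M S s ↔ B M S s) : CodeDef Q C n B :=
  let ⟨φ, hφ⟩ := hA
  ⟨φ, fun M _ S f S' hS s => (hφ M S f S' hS s).trans (h M S' s)⟩

theorem CodeDef.and (hA : CodeDef Q C n A) (hB : CodeDef Q C n B) :
    CodeDef Q C n (fun M S s => A M S s ∧ B M S s) :=
  let ⟨φ, hφ⟩ := hA
  let ⟨ψ, hψ⟩ := hB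
  ⟨.and φ ψ, fun M _ S f S' hS s => and_congr (hφ M S f S' hS s) (hψ M S f S' hS s)⟩

theorem CodeDef.or (hA : CodeDef Q C n A) (hB : CodeDef Q C n B) :
    CodeDef Q C n (fun M S s => A M S s ∨ B M S s) :=
  let ⟨φ, hφ⟩ := hA
  let ⟨ψ, hψ⟩ := hB
  ⟨.or φ ψ, fun M _ S f S' hS s => or_congr (hφ M S f S' hS s) (hψ M S f S' hS s)⟩

theorem CodeDef.ex {A : ∀ M : Type u, L'.Structure M → (Fin (n + 1) → M) → Prop}
    (hA : CodeDef Q C (n + 1) A) :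
    CodeDef Q C n (fun M S s => ∃ a, A M S (Fin.snoc s a)) :=
  let ⟨φ, hφ⟩ := hA
  ⟨.ex φ, fun M _ S f S' hS _ => exists_congr fun _ => hφ M S f S' hS _⟩

theorem CodeDef.all {A : ∀ M : Type u, L'.Structure M → (Fin (n + 1) → M) → Prop}
    (hA : CodeDef Q C (n + 1) A) :
    CodeDef Q C n (fun M S s => ∀ a, A M S (Fin.snoc s a)) :=
  let ⟨φ, hφ⟩ := hA
  ⟨.all φ, fun M _ S f S' hS _ => forall_congr' fun _ => hφ M S f S' hS _⟩

theorem CodeDef.quant {A : ∀ M : Type u, L'.Structure M → (Fin (n + k) → M) → Prop} (i : ι)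
    (hA : CodeDef Q C (n + k) A) :
    CodeDef Q C n (fun M S s => {a : Fin k → M | A M S (Fin.append s a)} ∈ Q i M) := by
  obtain ⟨φ, hφ⟩ := hA
  refine ⟨.quant i φ, fun M _ S f S' hS s => ?_⟩
  simp only [FunFormula.Sat, hφ M S f S' hS]

theorem CodeDef.exs : ∀ {r : ℕ}
    {A : ∀ M : Type u, L'.Structure M → (Fin (n + r) → M) → Prop}, CodeDef Q C (n + r) A →
      CodeDef Q C n (fun M S s => ∃ a : Fin r → M, A M S (Fin.append s a))
  | 0, _, hA => CodeDef.congr hA fun _ _ _ _ => (exists_append_zero _ _).symm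
  | _ + 1, _, hA => (CodeDef.exs (CodeDef.ex hA)).congr fun _ _ _ _ =>
      (exists_append_succ _ _).symm

theorem CodeDef.forallFin_and (hB : CodeDef Q C n B) : ∀ {r : ℕ}
    {A : Fin r → ∀ M : Type u, L'.Structure M → (Fin n → M) → Prop},
    (∀ j, CodeDef Q C n (A j)) → CodeDef Q C n (fun M S s => (∀ j, A j M S s) ∧ B M S s)
  | 0, _, _ => hB.congr fun _ _ _ _ => by simp
  | _ + 1, _, hA => ((hA 0).and (CodeDef.forallFin_and hB fun j => hA j.succ)).congr
      fun _ _ _ _ => by rw [Fin.forall_fin_succ, and_assoc]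

theorem CodeDef.varEq (x y : Fin n) : CodeDef Q C n (fun _ _ s => s x = s y) :=
  ⟨.lit (.eq (.var x) (.var y)), fun _ _ _ _ _ _ _ => Iff.rfl⟩

theorem CodeDef.varNe (x y : Fin n) : CodeDef Q C n (fun _ _ s => s x ≠ s y) :=
  ⟨.nlit (.eq (.var x) (.var y)), fun _ _ _ _ _ _ _ => Iff.rfl⟩

theorem CodeDef.funMap_eq {r : ℕ} (g : L'.Functions r) (x : Fin r → Fin n) (y : Fin n) :
    CodeDef Q C n (fun _ S s => S.funMap g (s ∘ x) = s y) := by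
  rcases h : C.fn g with g' | ⟨i, c⟩
  · refine ⟨.lit (.eq (.func g' fun i => .var (x i)) (.var y)), fun M _ S f S' hS s => ?_⟩
    have := hS.fn g
    rw [h] at this
    beta_reduce
    rw [this]
    rfl
  · refine ⟨.val i c x y, fun M _ S f S' hS s => ?_⟩
    have := hS.fn g
    rw [h] at this
    exact forall_comp_eq_iff this _ _

theorem CodeDef.relMap {r : ℕ} (R : L'.Relations r) (x : Fin r → Fin n) :
    CodeDef Q C n (fun _ S s => S.RelMap R (s ∘ x)) := by
  rcases h : C.rl R with R' | _ | ⟨i, j, c⟩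
  · refine ⟨.lit (.rel R' fun i => .var (x i)), fun M _ S f S' hS s => ?_⟩
    have := hS.rl R
    rw [h] at this
    beta_reduce
    rw [this]
    rfl
  -- An element different from itself serves as falsity.
  · refine ⟨.ex (.nlit (.eq (.var (Fin.last n)) (.var (Fin.last n)))),
      fun M _ S f S' hS s => ?_⟩
    have := hS.rl R
    rw [h] at this
    simp [FunFormula.Sat, Atom.Holds, this _]
  · refine ⟨.ex (.and (.val i c (Fin.castSucc ∘ x) (Fin.last n))
      (.val j c (Fin.castSucc ∘ x) (Fin.last n))), fun M _ S f S' hS s => ?_⟩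
    have := hS.rl R
    rw [h] at this
    obtain ⟨g₁, g₂, h₁, h₂, hR⟩ := this
    simp only [FunFormula.Sat, ← Function.comp_assoc, snoc_comp_castSucc_eq, Fin.snoc_last,
      forall_comp_eq_iff h₁, forall_comp_eq_iff h₂, hR]
    exact exists_eq_left'.trans eq_comm

/-- `val` has no negated form. Since function values are unique, lying outside an equalizer can be
said positively: the two functions take values that are distinct. -/
theorem CodeDef.not_relMap {r : ℕ} (R : L'.Relations r) (x : Fin r → Fin n) :
    CodeDef Q C n (fun _ S s => ¬ S.RelMap R (s ∘ x)) := by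
  rcases h : C.rl R with R' | _ | ⟨i, j, c⟩
  · refine ⟨.nlit (.rel R' fun i => .var (x i)), fun M _ S f S' hS s => ?_⟩
    have := hS.rl R
    rw [h] at this
    beta_reduce
    rw [this]
    rfl
  -- This formula is true because the universe is nonempty.
  · refine ⟨.ex (.lit (.eq (.var (Fin.last n)) (.var (Fin.last n)))),
      fun M _ S f S' hS s => ?_⟩
    have := hS.rl R
    rw [h] at this
    simp [FunFormula.Sat, Atom.Holds, this _]
  · refine ⟨.ex (.ex (.and (.and (.val i c (Fin.castSucc ∘ Fin.castSucc ∘ x) (Fin.last _).castSucc)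
      (.val j c (Fin.castSucc ∘ Fin.castSucc ∘ x) (Fin.last _)))
      (.nlit (.eq (.var (Fin.last _).castSucc) (.var (Fin.last _)))))), fun M _ S f S' hS s => ?_⟩
    have := hS.rl R
    rw [h] at this
    obtain ⟨g₁, g₂, h₁, h₂, hR⟩ := this
    simp only [FunFormula.Sat, Atom.Holds, FirstOrder.Language.Term.realize_var,
      ← Function.comp_assoc, snoc_comp_castSucc_eq, Fin.snoc_last, Fin.snoc_castSucc,
      forall_comp_eq_iff h₁, forall_comp_eq_iff h₂, hR, and_assoc, exists_and_left,
      exists_eq_left']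

/-- Coded symbols cannot be nested in terms, so the values of the subterms are named by
existentially quantified variables; these values are unique. -/
theorem CodeDef.realize_eq {q : ℕ} (t : L'.Term (Fin q)) :
    ∀ {n : ℕ} (x : Fin q → Fin n) (y : Fin n),
      CodeDef Q C n (fun _ _ s => t.realize (s ∘ x) = s y) := by
  induction t with
  | var i => exact fun x y => CodeDef.varEq (x i) y
  | @func r g ts ih =>
    intro n x y
    refine ((CodeDef.funMap_eq g (Fin.natAdd n) (Fin.castAdd r y)).forallFin_and
      (fun j => ih j (Fin.castAdd r ∘ x) (Fin.natAdd n j))).exs.congr fun M _ S s => ?_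
    simp only [← Function.comp_assoc, append_comp_castAdd, append_comp_natAdd, Fin.append_left,
      Fin.append_right, ← funext_iff]
    exact exists_eq_left'

theorem CodeDef.atom (a : Atom L' n) : CodeDef Q C n (fun _ S s => a.Holds S s) := by
  cases a with
  | eq t₁ t₂ =>
    refine ((CodeDef.realize_eq t₁ Fin.castSucc (Fin.last n)).and
      (CodeDef.realize_eq t₂ Fin.castSucc (Fin.last n))).ex.congr fun M _ S s => ?_
    simp only [snoc_comp_castSucc_eq, Fin.snoc_last, exists_eq_left']
    exact eq_comm
  | @rel r R ts =>
    refine ((CodeDef.relMap R (Fin.natAdd n)).forallFin_and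
      (fun j => CodeDef.realize_eq (ts j) (Fin.castAdd r) (Fin.natAdd n j))).exs.congr
      fun M _ S s => ?_
    simp only [append_comp_castAdd, append_comp_natAdd, Fin.append_right, ← funext_iff]
    exact exists_eq_left'

theorem CodeDef.natom (a : Atom L' n) : CodeDef Q C n (fun _ S s => ¬ a.Holds S s) := by
  cases a with
  | eq t₁ t₂ =>
    refine (((CodeDef.realize_eq t₁ (Fin.castSucc ∘ Fin.castSucc) (Fin.last n).castSucc).and
      (CodeDef.realize_eq t₂ (Fin.castSucc ∘ Fin.castSucc) (Fin.last _))).and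
      (CodeDef.varNe (Fin.last n).castSucc (Fin.last _))).ex.ex.congr fun M _ S s => ?_
    simp only [← Function.comp_assoc, snoc_comp_castSucc_eq, Fin.snoc_last, Fin.snoc_castSucc,
      and_assoc, exists_and_left, exists_eq_left']
    rfl
  | @rel r R ts =>
    refine ((CodeDef.not_relMap R (Fin.natAdd n)).forallFin_and
      (fun j => CodeDef.realize_eq (ts j) (Fin.castAdd r) (Fin.natAdd n j))).exs.congr
      fun M _ S s => ?_
    simp only [append_comp_castAdd, append_comp_natAdd, Fin.append_right, ← funext_iff]
    exact exists_eq_left'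

/-- Every relation is an equalizer of two functions or the empty relation. -/
theorem exists_relation_iff {M : Type u} [Nonempty M] {r : ℕ}
    (A : ((Fin r → M) → Prop) → Prop) :
    (∃ R, A R) ↔ (∃ g₁ g₂ : (Fin r → M) → M, A fun x => g₁ x = g₂ x) ∨ A fun _ => False := by
  constructor
  · rintro ⟨R, hR⟩
    by_cases hM : ∃ a b : M, a ≠ b
    · classical
      obtain ⟨a, b, hab⟩ := hM
      refine Or.inl ⟨fun _ => a, fun x => if R x then a else b, ?_⟩
      convert hR using 2 with x
      by_cases h : R x <;> simp [h, hab]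
    -- Over a one-element universe any two functions agree, so equalizers give only the full
    -- relation; the second alternative supplies the empty one.
    · push Not at hM
      have : Subsingleton M := ⟨hM⟩
      by_cases h : ∃ x, R x
      · obtain ⟨x, hx⟩ := h
        refine Or.inl ⟨fun _ => Classical.arbitrary M, fun _ => Classical.arbitrary M, ?_⟩
        convert hR using 2 with y
        rw [Subsingleton.elim y x]
        simpa using hx
      · refine Or.inr ?_
        convert hR using 2 with y
        simpa using not_exists.1 h y
  · rintro (⟨g₁, g₂, h⟩ | h)
    exacts [⟨_, h⟩, ⟨_, h⟩]

/-- For sufficiently large `m`, every formula of `ESO(Q_i : i ∈ ι)` is equivalent, relative to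
every coding by functions of arity `m`, to a `FunFormula`. -/
theorem ESOFormula.codeDef (φ : ESOFormula k ι L' n) :
    ∃ m₀, ∀ m, m₀ ≤ m → ∀ {p : ℕ} (C : Coding L L' m p),
      CodeDef Q C n (fun _ S s => φ.Sat Q S s) := by
  induction φ with
  | atom a => exact ⟨0, fun m _ p C => .atom a⟩
  | natom a => exact ⟨0, fun m _ p C => .natom a⟩
  | and φ ψ ih₁ ih₂ =>
    obtain ⟨m₁, h₁⟩ := ih₁
    obtain ⟨m₂, h₂⟩ := ih₂
    exact ⟨max m₁ m₂, fun m hm p C => (h₁ m (le_of_max_le_left hm) C).and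
      (h₂ m (le_of_max_le_right hm) C)⟩
  | or φ ψ ih₁ ih₂ =>
    obtain ⟨m₁, h₁⟩ := ih₁
    obtain ⟨m₂, h₂⟩ := ih₂
    exact ⟨max m₁ m₂, fun m hm p C => (h₁ m (le_of_max_le_left hm) C).or
      (h₂ m (le_of_max_le_right hm) C)⟩
  | ex φ ih =>
    obtain ⟨m₀, h⟩ := ih
    exact ⟨m₀, fun m hm p C => (h m hm C).ex⟩
  | all φ ih =>
    obtain ⟨m₀, h⟩ := ih
    exact ⟨m₀, fun m hm p C => (h m hm C).all⟩
  | quant i φ ih =>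
    obtain ⟨m₀, h⟩ := ih
    exact ⟨m₀, fun m hm p C => (h m hm C).quant i⟩
  | exFun r φ ih =>
    obtain ⟨m₀, h⟩ := ih
    refine ⟨max m₀ r, fun m hm p C => ?_⟩
    -- The bound on `m` must dominate every quantified arity so that this embedding exists.
    let c : Fin r ↪ Fin m := Fin.castLEEmb (le_of_max_le_right hm)
    obtain ⟨χ, hχ⟩ := h m (le_of_max_le_left hm) (C.addFun c)
    exact ⟨.exFun c χ, fun M _ S f S' hS s =>
      exists_congr fun g => hχ M S _ _ (hS.addFun c g) s⟩
  | exRel r φ ih =>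
    obtain ⟨m₀, h⟩ := ih
    refine ⟨max m₀ r, fun m hm p C => ?_⟩
    let c : Fin r ↪ Fin m := Fin.castLEEmb (le_of_max_le_right hm)
    obtain ⟨χ₁, h₁⟩ := h m (le_of_max_le_left hm) (C.addRel c)
    obtain ⟨χ₂, h₂⟩ := h m (le_of_max_le_left hm) (C.addEmpty r)
    refine ⟨.or (.exFun c (.exFun c χ₁)) χ₂, fun M _ S f S' hS s => ?_⟩
    refine Iff.trans ?_ (exists_relation_iff (M := M) _).symm
    exact or_congr (exists_congr fun g₁ => exists_congr fun g₂ =>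
      h₁ M S _ _ (hS.addRel c g₁ g₂) s) (h₂ M S _ _ (hS.addEmpty r) s)

theorem ESOFormula.exists_funFormula (φ : ESOFormula k ι L n) :
    ∃ (m : ℕ) (χ : FunFormula k ι L m 0 n), ∀ (M : Type u) [Nonempty M] (S : L.Structure M)
      (f : Fin 0 → (Fin m → M) → M) (s : Fin n → M), φ.Sat Q S s ↔ χ.Sat Q S f s := by
  obtain ⟨m, h⟩ := φ.codeDef (L := L) (Q := Q)
  obtain ⟨χ, hχ⟩ := h m le_rfl (Coding.refl L m)
  exact ⟨m, χ, fun M _ S f s => (hχ M S f S (Coding.models_refl S f) s).symm⟩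

end CodeDef

end Coding

/-! ### Definability in dependence logic -/

/-- A class of teams with variables in `V` is definable in `D(Q_i : i ∈ ι)` if it is downward
closed and, for every representation of the elements of `V` by the variables of a formula, some
formula defines it. -/
structure DDef {k : ℕ} {ι : Type} (Q : ι → GenQuantifier.{u} k) (L : FirstOrder.Language.{v, w})
    (V : Type) (P : ∀ M : Type u, L.Structure M → Set (V → M) → Prop) : Prop where
  mono : ∀ {M : Type u} [Nonempty M] {S : L.Structure M} {X Y : Set (V → M)},
    X ⊆ Y → P M S Y → P M S X
  formula : ∀ {N : ℕ} (e : V → Fin N), ∃ ψ : DFormula k ι L N,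
    ∀ (M : Type u) [Nonempty M] (S : L.Structure M) (X : Set (Fin N → M)),
      ψ.Sat Q S X ↔ P M S ((· ∘ e) '' X)

/-- A quantifier that is expressible in `D(Q_i : i ∈ ι)`, acting on teams by extension. -/
structure DQuantifier {k : ℕ} {ι : Type} (Q : ι → GenQuantifier.{u} k)
    (L : FirstOrder.Language.{v, w}) {r : ℕ} (U : GenQuantifier.{u} r) : Prop where
  mono : U.Mono
  formula : ∀ {n : ℕ} (φ : DFormula k ι L (n + r)), ∃ ψ : DFormula k ι L n,
    ∀ (M : Type u) (S : L.Structure M) (X : Set (Fin n → M)), ψ.Sat Q S X ↔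
      ∃ X', (∀ s ∈ X, {a | Fin.append s a ∈ X'} ∈ U M) ∧ φ.Sat Q S X'

/-- The existential quantifier for `r`-tuples. -/
def existsQuantifier (r : ℕ) : GenQuantifier.{u} r := fun _ => {A | A.Nonempty}

/-- The universal quantifier for `r`-tuples. -/
def forallQuantifier (r : ℕ) : GenQuantifier.{u} r := fun _ => {A | ∀ a, a ∈ A}

section DDef

variable {k : ℕ} {ι : Type} {Q : ι → GenQuantifier.{u} k} {L : FirstOrder.Language.{v, w}}
  {V V' W : Type}

theorem dQuantifier_quant (hQ : ∀ i, (Q i).Mono) (i : ι) : DQuantifier Q L (Q i) :=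
  ⟨hQ i, fun φ => ⟨.quant i φ, fun _ _ _ => DFormula.sat_quant_iff⟩⟩

theorem dQuantifier_exists (r : ℕ) : DQuantifier Q L (existsQuantifier.{u} r) := by
  refine ⟨fun M A B h hA => hA.mono h, ?_⟩
  induction r with
  | zero =>
    refine fun {n} φ => ⟨φ, fun M S X => ⟨fun h => ⟨X, fun s hs => ?_, h⟩, ?_⟩⟩
    · exact (exists_append_zero s fun x => x ∈ X).2 hs
    · rintro ⟨X', hX', h⟩
      exact h.mono fun s hs => (exists_append_zero s fun x => x ∈ X').1 (hX' s hs)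
  | succ r ih =>
    intro n φ
    obtain ⟨ψ, hψ⟩ := ih (n := n) (.ex φ)
    refine ⟨ψ, fun M S X => ?_⟩
    rw [hψ]
    simp only [DFormula.sat_ex_iff]
    constructor
    · rintro ⟨X₁, h₁, X₂, h₂, h⟩
      refine ⟨X₂, fun s hs => (exists_append_succ s fun x => x ∈ X₂).2 ?_, h⟩
      obtain ⟨a, ha⟩ := h₁ s hs
      exact ⟨a, h₂ _ ha⟩
    · rintro ⟨X', hX', h⟩
      exact ⟨{x : Fin (n + r) → M | ∃ b, (Fin.snoc x b : Fin (n + r + 1) → M) ∈ X'}, fun s hs =>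
        (exists_append_succ s fun x => x ∈ X').1 (hX' s hs), X', fun s hs => hs, h⟩

theorem dQuantifier_forall (r : ℕ) : DQuantifier Q L (forallQuantifier.{u} r) := by
  refine ⟨fun M A B h hA a => h (hA a), ?_⟩
  induction r with
  | zero =>
    refine fun {n} φ => ⟨φ, fun M S X => ⟨fun h => ⟨X, fun s hs => ?_, h⟩, ?_⟩⟩
    · exact (forall_append_zero s fun x => x ∈ X).2 hs
    · rintro ⟨X', hX', h⟩
      exact h.mono fun s hs => (forall_append_zero s fun x => x ∈ X').1 (hX' s hs)
  | succ r ih =>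
    intro n φ
    obtain ⟨ψ, hψ⟩ := ih (n := n) (.all φ)
    refine ⟨ψ, fun M S X => ?_⟩
    rw [hψ]
    simp only [DFormula.sat_all_iff]
    constructor
    · rintro ⟨X₁, h₁, X₂, h₂, h⟩
      exact ⟨X₂, fun s hs => (forall_append_succ s fun x => x ∈ X₂).2
        fun a => h₂ _ (h₁ s hs a), h⟩
    · rintro ⟨X', hX', h⟩
      exact ⟨{x : Fin (n + r) → M | ∀ b, (Fin.snoc x b : Fin (n + r + 1) → M) ∈ X'}, fun s hs =>
        (forall_append_succ s fun x => x ∈ X').1 (hX' s hs), X', fun s hs => hs, h⟩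

variable {P P' : ∀ M : Type u, L.Structure M → Set (V → M) → Prop}

theorem DDef.congr (hP : DDef Q L V P)
    (h : ∀ (M : Type u) [Nonempty M] S X, P M S X ↔ P' M S X) : DDef Q L V P' where
  mono hXY hY := (h _ _ _).1 (hP.mono hXY ((h _ _ _).2 hY))
  formula e :=
    let ⟨ψ, hψ⟩ := hP.formula e
    ⟨ψ, fun M _ S X => (hψ M S X).trans (h _ _ _)⟩

theorem DDef.comap {P : ∀ M : Type u, L.Structure M → Set (V' → M) → Prop} (hP : DDef Q L V' P)
    (σ : V' → V) : DDef Q L V (fun M S X => P M S ((· ∘ σ) '' X)) where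
  mono hXY hY := hP.mono (Set.image_mono hXY) hY
  formula e := by
    obtain ⟨ψ, hψ⟩ := hP.formula (e ∘ σ)
    refine ⟨ψ, fun M _ S X => ?_⟩
    rw [hψ, Set.image_image]
    rfl

theorem DDef.and (hP : DDef Q L V P) (hP' : DDef Q L V P') :
    DDef Q L V (fun M S X => P M S X ∧ P' M S X) where
  mono hXY hY := ⟨hP.mono hXY hY.1, hP'.mono hXY hY.2⟩
  formula e :=
    let ⟨ψ, hψ⟩ := hP.formula e
    let ⟨ψ', hψ'⟩ := hP'.formula e
    ⟨.and ψ ψ', fun M _ S X => and_congr (hψ M S X) (hψ' M S X)⟩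

theorem DDef.or (hP : DDef Q L V P) (hP' : DDef Q L V P') :
    DDef Q L V (fun M S X => ∃ Y Z, X ⊆ Y ∪ Z ∧ P M S Y ∧ P' M S Z) where
  mono := fun hXY ⟨Y, Z, h, h₁, h₂⟩ => ⟨Y, Z, hXY.trans h, h₁, h₂⟩
  formula e := by
    obtain ⟨ψ, hψ⟩ := hP.formula e
    obtain ⟨ψ', hψ'⟩ := hP'.formula e
    refine ⟨.or ψ ψ', fun M _ S X => ?_⟩
    simp only [DFormula.sat_or_iff, hψ, hψ']
    constructor
    · rintro ⟨Y, Z, h, h₁, h₂⟩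
      exact ⟨_, _, (Set.image_mono h).trans (Set.image_union _ _ _).le, h₁, h₂⟩
    · rintro ⟨Y, Z, h, h₁, h₂⟩
      exact ⟨(· ∘ e) ⁻¹' Y, (· ∘ e) ⁻¹' Z, fun x hx => h ⟨x, hx, rfl⟩,
        hP.mono (Set.image_preimage_subset _ _) h₁,
        hP'.mono (Set.image_preimage_subset _ _) h₂⟩

theorem DDef.forallFin_and (hP : DDef Q L V P) : ∀ {r : ℕ}
    {R : Fin r → ∀ M : Type u, L.Structure M → Set (V → M) → Prop},
    (∀ j, DDef Q L V (R j)) → DDef Q L V (fun M S X => (∀ j, R j M S X) ∧ P M S X)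
  | 0, _, _ => hP.congr fun _ _ _ _ => by simp
  | _ + 1, _, hR => ((hR 0).and (DDef.forallFin_and hP fun j => hR j.succ)).congr
      fun _ _ _ _ => by rw [Fin.forall_fin_succ, and_assoc]

/-- Assignments of the formula that agree on `V` are identified in the abstract team, so a section
there can be larger than the section over any one of them. Monotonicity of `U` absorbs the
difference. -/
theorem DDef.quantify {r : ℕ} {U : GenQuantifier.{u} r} (hU : DQuantifier Q L U)
    {P : ∀ M : Type u, L.Structure M → Set (V ⊕ Fin r → M) → Prop} (hP : DDef Q L (V ⊕ Fin r) P) :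
    DDef Q L V (fun M S X =>
      ∃ X', (∀ x ∈ X, {a | Sum.elim x a ∈ X'} ∈ U M) ∧ P M S X') where
  mono := fun hXY ⟨X', hX', h⟩ => ⟨X', fun x hx => hX' x (hXY hx), h⟩
  formula {N} e := by
    obtain ⟨φ, hφ⟩ := hP.formula (Sum.elim (Fin.castAdd r ∘ e) (Fin.natAdd N))
    obtain ⟨ψ, hψ⟩ := hU.formula φ
    have key {M : Type u} (y : Fin N → M) (a : Fin r → M) :
        Fin.append y a ∘ Sum.elim (Fin.castAdd r ∘ e) (Fin.natAdd N) = Sum.elim (y ∘ e) a := by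
      rw [Sum.comp_elim, ← Function.comp_assoc, append_comp_castAdd, append_comp_natAdd]
    refine ⟨ψ, fun M _ S X => ?_⟩
    simp only [hψ, hφ]
    constructor
    · rintro ⟨X', hX', h⟩
      refine ⟨_, ?_, h⟩
      rintro _ ⟨y, hy, rfl⟩
      exact hU.mono _ _ _ (fun a ha => ⟨_, ha, key y a⟩) (hX' y hy)
    · rintro ⟨X', hX', h⟩
      refine ⟨_, fun y hy => ?_, hP.mono (Set.image_preimage_subset _ X') h⟩
      simp only [Set.mem_preimage, key]
      exact hX' _ ⟨y, hy, rfl⟩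

theorem DDef.alls {r : ℕ} {P : ∀ M : Type u, L.Structure M → Set (V ⊕ Fin r → M) → Prop}
    (hP : DDef Q L (V ⊕ Fin r) P) :
    DDef Q L V (fun M S X => P M S {y | y ∘ Sum.inl ∈ X}) := by
  refine (hP.quantify (dQuantifier_forall r)).congr fun M _ S X => ⟨?_, fun h => ⟨_, ?_, h⟩⟩
  · rintro ⟨X', hX', h⟩
    refine hP.mono (fun y hy => ?_) h
    rw [← Sum.elim_comp_inl_inr y]
    exact hX' _ hy _
  · exact fun x hx a => hx

theorem DDef.dep [Finite W] (key : W → V) (v : V) :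
    DDef Q L V (fun _ _ X => ∀ x ∈ X, ∀ x' ∈ X, x ∘ key = x' ∘ key → x v = x' v) where
  mono := fun hXY h x hx x' hx' => h x (hXY hx) x' (hXY hx')
  formula e := by
    obtain ⟨r, ⟨f⟩⟩ := Finite.exists_equiv_fin W
    refine ⟨.dep (fun i => .var (e (key (f.symm i)))) (.var (e v)), fun M _ S X => ?_⟩
    simp only [DFormula.Sat, Set.forall_mem_image, FirstOrder.Language.Term.realize_var,
      funext_iff, Function.comp_apply, f.symm.forall_congr_left, Equiv.symm_symm,
      Equiv.symm_apply_apply]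

theorem DDef.atom {n : ℕ} (a : Atom L n) (σ : Fin n → V) :
    DDef Q L V (fun _ S X => ∀ x ∈ X, a.Holds S (x ∘ σ)) where
  mono := fun hXY h x hx => h x (hXY hx)
  formula e := by
    refine ⟨.atom (a.relabel (e ∘ σ)), fun M _ S X => ?_⟩
    simp only [DFormula.Sat, Set.forall_mem_image, Atom.holds_relabel, Function.comp_assoc]

theorem DDef.natom {n : ℕ} (a : Atom L n) (σ : Fin n → V) :
    DDef Q L V (fun _ S X => ∀ x ∈ X, ¬ a.Holds S (x ∘ σ)) where
  mono := fun hXY h x hx => h x (hXY hx)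
  formula e := by
    refine ⟨.natom (a.relabel (e ∘ σ)), fun M _ S X => ?_⟩
    simp only [DFormula.Sat, Set.forall_mem_image, Atom.holds_relabel, Function.comp_assoc]

theorem DDef.varEq (v v' : V) : DDef Q L V (fun _ _ X => ∀ x ∈ X, x v = x v') :=
  DDef.atom (n := 2) (.eq (.var 0) (.var 1)) ![v, v']

theorem DDef.varNe (v v' : V) : DDef Q L V (fun _ _ X => ∀ x ∈ X, x v ≠ x v') :=
  DDef.natom (n := 2) (.eq (.var 0) (.var 1)) ![v, v']

theorem DDef.flat_or {A B : ∀ M : Type u, L.Structure M → (V → M) → Prop}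
    (hA : DDef Q L V (fun M S X => ∀ x ∈ X, A M S x))
    (hB : DDef Q L V (fun M S X => ∀ x ∈ X, B M S x)) :
    DDef Q L V (fun M S X => ∀ x ∈ X, A M S x ∨ B M S x) := by
  refine (hA.or hB).congr fun M _ S X => ⟨?_, fun h => ⟨{x | A M S x}, {x | B M S x}, h,
    fun x hx => hx, fun x hx => hx⟩⟩
  rintro ⟨Y, Z, h, h₁, h₂⟩ x hx
  exact (h hx).imp (h₁ x) (h₂ x)

/-- Rowwise, the implication is a disjunction of inequations and one equation, and team disjunction
of flat properties is pointwise. -/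
theorem DDef.flat_imp_varEq (v v' : V) : ∀ {r : ℕ} (a b : Fin r → V),
    DDef Q L V (fun _ _ X => ∀ x ∈ X, x ∘ a = x ∘ b → x v = x v')
  | 0, a, b => (DDef.varEq v v').congr fun _ _ _ X =>
      forall₂_congr fun x _ => by simp [Subsingleton.elim (x ∘ a) (x ∘ b)]
  | r + 1, a, b => (DDef.flat_or (A := fun _ _ x => x (a 0) ≠ x (b 0)) (DDef.varNe (a 0) (b 0))
      (DDef.flat_imp_varEq v v' (a ∘ Fin.succ) (b ∘ Fin.succ))).congr fun _ _ _ X =>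
      forall₂_congr fun x _ => by
        simp only [funext_iff, Fin.forall_fin_succ, Function.comp_apply]
        tauto

/-- Existential witnesses constrained by one dependence atom per coordinate are exactly the values
of a function of the key. This is how function quantification enters dependence logic. -/
theorem DDef.exKey [Finite W] (key : W → V) {r : ℕ}
    {P : ∀ M : Type u, L.Structure M → Set (V ⊕ Fin r → M) → Prop}
    (hP : DDef Q L (V ⊕ Fin r) P) :
    DDef Q L V (fun M S X => ∃ g : (W → M) → Fin r → M,
      P M S {y | y ∘ Sum.inl ∈ X ∧ y ∘ Sum.inr = g (y ∘ Sum.inl ∘ key)}) := by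
  refine ((hP.forallFin_and fun i => DDef.dep (Sum.inl ∘ key) (Sum.inr i)).quantify
    (dQuantifier_exists r)).congr fun M _ S X => ⟨?_, ?_⟩
  · rintro ⟨X', hX', hdep, h⟩
    choose a ha using hX'
    have hex : ∀ w : W → M, ∃ b : Fin r → M, ∀ x (hx : x ∈ X), x ∘ key = w → a x hx = b := by
      intro w
      by_cases hw : ∃ x ∈ X, x ∘ key = w
      · obtain ⟨x, hx, rfl⟩ := hw
        refine ⟨a x hx, fun x' hx' hk => funext fun i => ?_⟩
        exact hdep i _ (ha x' hx') _ (ha x hx) hk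
      -- Key values not realized in the team are unconstrained.
      · exact ⟨fun _ => Classical.arbitrary M, fun x hx hk => (hw ⟨x, hx, hk⟩).elim⟩
    choose g hg using hex
    refine ⟨g, hP.mono ?_ h⟩
    rintro y ⟨hy, hyg⟩
    rw [← Sum.elim_comp_inl_inr y, hyg, ← Function.comp_assoc, ← hg _ _ hy rfl]
    exact ha _ hy
  · rintro ⟨g, h⟩
    refine ⟨{y | y ∘ Sum.inl ∈ X ∧ y ∘ Sum.inr = g (y ∘ Sum.inl ∘ key)},
      fun x hx => ⟨g (x ∘ key), hx, rfl⟩, ?_, h⟩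
    rintro i y ⟨-, hy⟩ y' ⟨-, hy'⟩ hk
    have := congrFun (hy.trans ((congrArg g hk).trans hy'.symm)) i
    exact this

/-- Splitting a team according to the values of finitely many variables. -/
theorem DDef.sep [Finite W] (key : W → V) (hP : DDef Q L V P) (hP' : DDef Q L V P') :
    DDef Q L V (fun M S X => ∃ B : Set (W → M),
      P M S {x ∈ X | x ∘ key ∈ B} ∧ P' M S {x ∈ X | x ∘ key ∉ B}) := by
  -- Two witnesses depending only on the key encode one bit, namely whether they are equal; the bit
  -- decides which half of the team a row joins.
  have hkey := (((DDef.varEq (Sum.inr (0 : Fin 2)) (Sum.inr (1 : Fin 2))).and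
    (hP.comap (Sum.inl (β := Fin 2)))).or
    ((DDef.varNe (Sum.inr (0 : Fin 2)) (Sum.inr (1 : Fin 2))).and
    (hP'.comap (Sum.inl (β := Fin 2))))).exKey key
  -- For a nonempty team this says that the universe has one element, where two witnesses cannot
  -- encode a bit. There a team has at most one member, so ordinary disjunction already splits by
  -- key.
  have hsub := (DDef.varEq (Q := Q) (L := L) (V := V ⊕ Fin 2) (Sum.inr 0) (Sum.inr 1)).alls
  refine (hkey.or (hsub.and (hP.or hP'))).congr fun M _ S X => ?_
  rcases subsingleton_or_nontrivial M with hM | ⟨a, b, hab⟩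
  · have hsing {x : V → M} (hx : x ∈ X) (Y : Set (V → M)) (hY : x ∈ Y) : X ⊆ Y :=
      fun x' _ => Subsingleton.elim x x' ▸ hY
    constructor
    · rintro ⟨Y, Z, hX, ⟨g, Y₁, Y₂, hY, ⟨-, h₁⟩, ⟨-, h₂⟩⟩, -, Z₁, Z₂, hZ, h₃, h₄⟩
      have huniv (h : P M S X) : ∃ B : Set (W → M),
          P M S {x ∈ X | x ∘ key ∈ B} ∧ P' M S {x ∈ X | x ∘ key ∉ B} :=
        ⟨Set.univ, by simpa using h, hP'.mono (by simp) h₂⟩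
      have hempty (h : P' M S X) : ∃ B : Set (W → M),
          P M S {x ∈ X | x ∘ key ∈ B} ∧ P' M S {x ∈ X | x ∘ key ∉ B} :=
        ⟨∅, hP.mono (by simp) h₁, by simpa using h⟩
      rcases X.eq_empty_or_nonempty with rfl | ⟨x, hx⟩
      · exact huniv (hP.mono (Set.empty_subset _) h₁)
      rcases hX hx with h | h
      · rcases hY (show Sum.elim x (g (x ∘ key)) ∈ _ from ⟨h, rfl⟩) with h | h
        · exact huniv (hP.mono (hsing hx ((· ∘ Sum.inl) '' Y₁) ⟨_, h, rfl⟩) h₁)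
        · exact hempty (hP'.mono (hsing hx ((· ∘ Sum.inl) '' Y₂) ⟨_, h, rfl⟩) h₂)
      · rcases hZ h with h | h
        · exact huniv (hP.mono (hsing hx _ h) h₃)
        · exact hempty (hP'.mono (hsing hx _ h) h₄)
    · rintro ⟨B, h₁, h₂⟩
      refine ⟨∅, X, by simp, ⟨fun _ _ => Classical.arbitrary M, ∅, ∅, ?_, ⟨by simp, ?_⟩,
        by simp, ?_⟩, fun _ _ => Subsingleton.elim _ _, _, _, ?_, h₁, h₂⟩
      · rintro y ⟨hy, -⟩
        exact hy.elim
      · exact hP.mono (by simp) h₁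
      · exact hP'.mono (by simp) h₂
      · intro x hx
        by_cases h : x ∘ key ∈ B
        exacts [Or.inl ⟨hx, h⟩, Or.inr ⟨hx, h⟩]
  · constructor
    · rintro ⟨Y, Z, hX, ⟨g, Y₁, Y₂, hY, ⟨he, h₁⟩, ⟨hn, h₂⟩⟩, hZ, -⟩
      have hXY {x : V → M} (hx : x ∈ X) : Sum.elim x (g (x ∘ key)) ∈ Y₁ ∪ Y₂ := by
        refine hY ⟨(hX hx).resolve_right fun h => hab ?_, rfl⟩
        exact hZ (Sum.elim x ![a, b]) h
      refine ⟨{w | g w 0 = g w 1}, hP.mono ?_ h₁, hP'.mono ?_ h₂⟩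
      · rintro x ⟨hx, hg⟩
        exact ⟨_, (hXY hx).resolve_right fun h => hn _ h hg, rfl⟩
      · rintro x ⟨hx, hg⟩
        exact ⟨_, (hXY hx).resolve_left fun h => hg (he _ h), rfl⟩
    · rintro ⟨B, h₁, h₂⟩
      classical
      refine ⟨X, ∅, by simp, ⟨fun w => if w ∈ B then ![a, a] else ![a, b],
        {y | y (Sum.inr 0) = y (Sum.inr 1) ∧ y ∘ Sum.inl ∈ {x ∈ X | x ∘ key ∈ B}},
        {y | y (Sum.inr 0) ≠ y (Sum.inr 1) ∧ y ∘ Sum.inl ∈ {x ∈ X | x ∘ key ∉ B}}, ?_,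
        ⟨fun y hy => hy.1, hP.mono ?_ h₁⟩, ⟨fun y hy => hy.1, hP'.mono ?_ h₂⟩⟩,
        fun y hy => hy.elim, ∅, ∅, by simp, hP.mono (Set.empty_subset _) h₁,
        hP'.mono (Set.empty_subset _) h₂⟩
      · rintro y ⟨hy, hg⟩
        have h0 := congrFun hg 0
        have h1 := congrFun hg 1
        by_cases h : y ∘ Sum.inl ∘ key ∈ B
        · refine Or.inl ⟨?_, hy, h⟩
          simp only [if_pos h] at h0 h1
          exact h0.trans h1.symm
        · refine Or.inr ⟨?_, hy, h⟩
          simp only [if_neg h] at h0 h1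
          exact fun h' => hab (h0.symm.trans (h'.trans h1))
      · rintro _ ⟨y, hy, rfl⟩
        exact hy.2
      · rintro _ ⟨y, hy, rfl⟩
        exact hy.2

end DDef

/-! ### Teams that represent functions -/

/-- Variables of a team that represents `p` functions of arity `m` together with a set of
assignments of `n` variables: the variables, the arguments and the values. -/
abbrev GraphVar (n m p : ℕ) : Type := Fin n ⊕ (Fin m ⊕ Fin p)

/-- The team of all assignments `s ∈ X` extended by all arguments `z` and the values at `z` of the
functions `f s`. -/
def graphTeam {n m p : ℕ} {M : Type u} (X : Set (Fin n → M))
    (f : (Fin n → M) → Fin p → (Fin m → M) → M) : Set (GraphVar n m p → M) :=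
  {y | y ∘ Sum.inl ∈ X ∧ ∀ i, y (Sum.inr (Sum.inr i)) = f (y ∘ Sum.inl) i (y ∘ Sum.inr ∘ Sum.inl)}

section graphTeam

variable {k : ℕ} {ι : Type} {Q : ι → GenQuantifier.{u} k} {L : FirstOrder.Language.{v, w}}
  {n m p r : ℕ}

theorem forall_mem_graphTeam {M : Type u} {X : Set (Fin n → M)}
    {f : (Fin n → M) → Fin p → (Fin m → M) → M} {A : (GraphVar n m p → M) → Prop} :
    (∀ y ∈ graphTeam X f, A y) ↔
      ∀ s ∈ X, ∀ z, A (Sum.elim s (Sum.elim z fun i => f s i z)) := by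
  constructor
  · exact fun h s hs z => h _ ⟨hs, fun i => rfl⟩
  · rintro h y ⟨hs, hf⟩
    convert h _ hs (y ∘ Sum.inr ∘ Sum.inl) using 1
    ext (i | i | i)
    exacts [rfl, rfl, hf i]

theorem forall_append_mem {M : Type u} {X : Set (Fin n → M)}
    {K : (Fin n → M) → (Fin r → M) → Prop} {A : (Fin n → M) → (Fin (n + r) → M) → Prop} :
    (∀ s ∈ {s : Fin (n + r) → M | s ∘ Fin.castAdd r ∈ X ∧
        K (s ∘ Fin.castAdd r) (s ∘ Fin.natAdd n)}, A (s ∘ Fin.castAdd r) s) ↔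
      ∀ s ∈ X, ∀ a, K s a → A s (Fin.append s a) := by
  constructor
  · intro h s hs a hK
    have := h (Fin.append s a)
    simp only [Set.mem_ofPred_eq, append_comp_castAdd, append_comp_natAdd] at this
    exact this ⟨hs, hK⟩
  · rintro h s ⟨hs, hK⟩
    have := h _ hs _ hK
    rwa [show Fin.append (s ∘ Fin.castAdd r) (s ∘ Fin.natAdd n) = s from
      Fin.append_castAdd_natAdd] at this

/-- The renaming that moves `r` appended variables to the end of the first block. -/
def appendVar (n m p r : ℕ) : GraphVar (n + r) m p → GraphVar n m p ⊕ Fin r :=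
  Sum.elim (Fin.append (Sum.inl ∘ Sum.inl) Sum.inr) (Sum.inl ∘ Sum.inr)

theorem image_appendVar {M : Type u} {X : Set (Fin n → M)}
    {f : (Fin n → M) → Fin p → (Fin m → M) → M} (K : (Fin n → M) → (Fin r → M) → Prop) :
    (· ∘ appendVar n m p r) '' {y : GraphVar n m p ⊕ Fin r → M |
        y ∘ Sum.inl ∈ graphTeam X f ∧ K (y ∘ Sum.inl ∘ Sum.inl) (y ∘ Sum.inr)} =
      graphTeam {s | s ∘ Fin.castAdd r ∈ X ∧ K (s ∘ Fin.castAdd r) (s ∘ Fin.natAdd n)}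
        (fun s => f (s ∘ Fin.castAdd r)) := by
  have key (y : GraphVar n m p ⊕ Fin r → M) : (y ∘ appendVar n m p r) ∘ Sum.inl =
      Fin.append (y ∘ Sum.inl ∘ Sum.inl) (y ∘ Sum.inr) :=
    comp_append y _ _
  ext x
  constructor
  · rintro ⟨y, ⟨⟨hX, hf⟩, hK⟩, rfl⟩
    refine ⟨?_, fun i => ?_⟩
    · simp only [key, Set.mem_ofPred_eq, append_comp_castAdd, append_comp_natAdd]
      exact ⟨hX, hK⟩
    · simp only [key, append_comp_castAdd]
      exact hf i
  · rintro ⟨⟨hX, hK⟩, hf⟩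
    refine ⟨Sum.elim (Sum.elim ((x ∘ Sum.inl) ∘ Fin.castAdd r) (x ∘ Sum.inr))
      ((x ∘ Sum.inl) ∘ Fin.natAdd n), ⟨⟨hX, hf⟩, hK⟩, ?_⟩
    refine funext (Sum.rec (fun i => ?_) (fun i => rfl))
    refine Fin.addCases (fun i => ?_) (fun i => ?_) i <;> simp [appendVar]

/-- The renaming that moves one appended variable to the end of the last block. -/
def appendVal (n m p : ℕ) : GraphVar n m (p + 1) → GraphVar n m p ⊕ Fin 1 :=
  Sum.elim (Sum.inl ∘ Sum.inl) (Sum.elim (Sum.inl ∘ Sum.inr ∘ Sum.inl)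
    (Fin.snoc (Sum.inl ∘ Sum.inr ∘ Sum.inr) (Sum.inr 0)))

theorem image_appendVal {M : Type u} {X : Set (Fin n → M)}
    {f : (Fin n → M) → Fin p → (Fin m → M) → M} (g : (Fin n → M) → (Fin m → M) → M) :
    (· ∘ appendVal n m p) '' {y : GraphVar n m p ⊕ Fin 1 → M | y ∘ Sum.inl ∈ graphTeam X f ∧
        y ∘ Sum.inr = fun _ => g (y ∘ Sum.inl ∘ Sum.inl) (y ∘ Sum.inl ∘ Sum.inr ∘ Sum.inl)} =
      graphTeam X (fun s => Fin.snoc (f s) (g s)) := by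
  ext x
  constructor
  · rintro ⟨y, ⟨⟨hX, hf⟩, hg⟩, rfl⟩
    refine ⟨hX, fun i => ?_⟩
    refine Fin.lastCases ?_ (fun i => ?_) i
    · simp only [appendVal, Function.comp_apply, Sum.elim_inr, Fin.snoc_last]
      exact congrFun hg 0
    · simp only [appendVal, Function.comp_apply, Sum.elim_inr, Fin.snoc_castSucc]
      exact hf i
  · rintro ⟨hX, hf⟩
    refine ⟨Sum.elim (Sum.elim (x ∘ Sum.inl) (Sum.elim (x ∘ Sum.inr ∘ Sum.inl)
      (x ∘ Sum.inr ∘ Sum.inr ∘ Fin.castSucc))) (fun _ => x (Sum.inr (Sum.inr (Fin.last p)))),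
      ⟨⟨hX, fun i => ?_⟩, funext fun i => ?_⟩, ?_⟩
    · have := hf i.castSucc
      simpa only [Fin.snoc_castSucc] using! this
    · have := hf (Fin.last p)
      simpa only [Fin.snoc_last] using! this
    · refine funext (Sum.rec (fun i => rfl) (fun i => ?_))
      rcases i with i | i
      · rfl
      · refine Fin.lastCases ?_ (fun i => ?_) i <;> simp [appendVal]

/-- A class of assignments and functions is flatly definable if some definable class of teams
consists, among the teams representing functions, of those in which all assignments have the
property. -/
def FlatDef (Q : ι → GenQuantifier.{u} k) (L : FirstOrder.Language.{v, w}) (m p n : ℕ)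
    (A : ∀ M : Type u, L.Structure M → (Fin p → (Fin m → M) → M) → (Fin n → M) → Prop) : Prop :=
  ∃ P, DDef Q L (GraphVar n m p) P ∧ ∀ (M : Type u) [Nonempty M] (S : L.Structure M)
    (X : Set (Fin n → M)) (f : (Fin n → M) → Fin p → (Fin m → M) → M),
      P M S (graphTeam X f) ↔ ∀ s ∈ X, A M S (f s) s

section FlatDef

variable {A B : ∀ M : Type u, L.Structure M → (Fin p → (Fin m → M) → M) → (Fin n → M) → Prop}

theorem FlatDef.lit (a : Atom L n) : FlatDef Q L m p n (fun _ S _ s => a.Holds S s) := by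
  refine ⟨_, DDef.atom a Sum.inl, fun M _ S X f => ?_⟩
  rw [forall_mem_graphTeam]
  exact forall₂_congr fun s _ => by simp only [Sum.elim_comp_inl, forall_const]

theorem FlatDef.nlit (a : Atom L n) : FlatDef Q L m p n (fun _ S _ s => ¬ a.Holds S s) := by
  refine ⟨_, DDef.natom a Sum.inl, fun M _ S X f => ?_⟩
  rw [forall_mem_graphTeam]
  exact forall₂_congr fun s _ => by simp only [Sum.elim_comp_inl, forall_const]

/-- The universal quantifier over `z` in `val` matches the rows of the graph team, so the condition
is checked row by row. -/
theorem FlatDef.val (i : Fin p) (c : Fin r → Fin m) (x : Fin r → Fin n) (y : Fin n) :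
    FlatDef Q L m p n (fun M _ f s => ∀ z : Fin m → M, z ∘ c = s ∘ x → f i z = s y) := by
  refine ⟨_, DDef.flat_imp_varEq (Sum.inr (Sum.inr i)) (Sum.inl y) (Sum.inr ∘ Sum.inl ∘ c)
    (Sum.inl ∘ x), fun M _ S X f => ?_⟩
  rw [forall_mem_graphTeam]
  rfl

theorem FlatDef.and (hA : FlatDef Q L m p n A) (hB : FlatDef Q L m p n B) :
    FlatDef Q L m p n (fun M S f s => A M S f s ∧ B M S f s) := by
  obtain ⟨P, hP, h⟩ := hA
  obtain ⟨P', hP', h'⟩ := hB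
  exact ⟨_, hP.and hP', fun M _ S X f => by rw [h, h', forall₂_and]⟩

/-- Plain team disjunction could divide the rows of a single `s` between the disjuncts, leaving each
with a partial function graph. Splitting by the key `s` keeps every graph whole. -/
theorem FlatDef.or (hA : FlatDef Q L m p n A) (hB : FlatDef Q L m p n B) :
    FlatDef Q L m p n (fun M S f s => A M S f s ∨ B M S f s) := by
  obtain ⟨P, hP, h⟩ := hA
  obtain ⟨P', hP', h'⟩ := hB
  refine ⟨_, hP.sep Sum.inl hP', fun M _ S X f => ?_⟩
  have key (B : Set (Fin n → M)) :
      {y ∈ graphTeam X f | y ∘ Sum.inl ∈ B} = graphTeam {s ∈ X | s ∈ B} f := by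
    ext y
    exact and_right_comm
  have key' (B : Set (Fin n → M)) :
      {y ∈ graphTeam X f | y ∘ Sum.inl ∉ B} = graphTeam {s ∈ X | s ∉ B} f := key Bᶜ
  simp only [key, key', h, h']
  constructor
  · rintro ⟨D, h₁, h₂⟩ s hs
    by_cases hD : s ∈ D
    exacts [Or.inl (h₁ s ⟨hs, hD⟩), Or.inr (h₂ s ⟨hs, hD⟩)]
  · exact fun h => ⟨{s | A M S (f s) s}, fun s hs => hs.2,
      fun s hs => (h s hs.1).resolve_left hs.2⟩

theorem FlatDef.ex
    {A : ∀ M : Type u, L.Structure M → (Fin p → (Fin m → M) → M) → (Fin (n + 1) → M) → Prop}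
    (hA : FlatDef Q L m p (n + 1) A) :
    FlatDef Q L m p n (fun M S f s => ∃ a, A M S f (Fin.snoc s a)) := by
  obtain ⟨P, hP, h⟩ := hA
  refine ⟨_, (hP.comap (appendVar n m p 1)).exKey Sum.inl, fun M _ S X f => ?_⟩
  have key (g : (Fin n → M) → Fin 1 → M) :=
    ((congrArg (P M S) (image_appendVar (X := X) (f := f) fun s a => a = g s)).to_iff.trans
      (h M S _ _)).trans (forall_append_mem (K := fun s a => a = g s)
        (A := fun s s' => A M S (f s) s'))
  refine (exists_congr key).trans ⟨?_, fun hs => ?_⟩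
  · rintro ⟨g, hg⟩ s hs
    exact ⟨g s 0, by simpa only [Fin.append_right_eq_snoc] using hg s hs _ rfl⟩
  · choose! g hg using hs
    refine ⟨fun s _ => g s, ?_⟩
    rintro s hs _ rfl
    simpa only [Fin.append_right_eq_snoc] using hg s hs

theorem FlatDef.all
    {A : ∀ M : Type u, L.Structure M → (Fin p → (Fin m → M) → M) → (Fin (n + 1) → M) → Prop}
    (hA : FlatDef Q L m p (n + 1) A) :
    FlatDef Q L m p n (fun M S f s => ∀ a, A M S f (Fin.snoc s a)) := by
  obtain ⟨P, hP, h⟩ := hA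
  refine ⟨_, (hP.comap (appendVar n m p 1)).alls, fun M _ S X f => ?_⟩
  have key := ((congrArg (P M S) (image_appendVar (X := X) (f := f) fun s (a : Fin 1 → M) =>
    True)).to_iff.trans (h M S _ _)).trans (forall_append_mem (K := fun _ _ => True)
      (A := fun s s' => A M S (f s) s'))
  simp only [and_true, true_implies] at key
  refine key.trans (forall₂_congr fun s _ => ?_)
  simp only [Fin.append_right_eq_snoc]
  exact ⟨fun h a => h fun _ => a, fun h a => h (a 0)⟩

/-- The new value may depend on `s`, since the quantifier lies in the scope of the individual
variables, but on `z` only through `z ∘ c`; these form the key. -/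
theorem FlatDef.exFun (c : Fin r → Fin m)
    {A : ∀ M : Type u, L.Structure M → (Fin (p + 1) → (Fin m → M) → M) → (Fin n → M) → Prop}
    (hA : FlatDef Q L m (p + 1) n A) :
    FlatDef Q L m p n (fun M S f s => ∃ g : (Fin r → M) → M,
      A M S (Fin.snoc f fun z => g (z ∘ c)) s) := by
  obtain ⟨P, hP, h⟩ := hA
  refine ⟨_, (hP.comap (appendVal n m p)).exKey (W := Fin n ⊕ Fin r)
    (Sum.elim Sum.inl (Sum.inr ∘ Sum.inl ∘ c)), fun M _ S X f => ?_⟩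
  have hcomp (y : GraphVar n m p ⊕ Fin 1 → M) :
      y ∘ Sum.inl ∘ Sum.elim Sum.inl (Sum.inr ∘ Sum.inl ∘ c) =
        Sum.elim (y ∘ Sum.inl ∘ Sum.inl) ((y ∘ Sum.inl ∘ Sum.inr ∘ Sum.inl) ∘ c) := by
    simp only [Sum.comp_elim, Function.comp_assoc]
  have key (g : (Fin n ⊕ Fin r → M) → M) :=
    (congrArg (P M S) (image_appendVal (X := X) (f := f)
      fun s z => g (Sum.elim s (z ∘ c)))).to_iff.trans (h M S _ _)
  simp only [hcomp]
  constructor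
  · rintro ⟨g, hg⟩ s hs
    obtain ⟨g, rfl⟩ : ∃ g', g = fun w _ => g' w :=
      ⟨fun w => g w 0, by ext w i; rw [Subsingleton.elim i 0]⟩
    exact ⟨fun b => g (Sum.elim s b), (key g).1 hg s hs⟩
  · intro hs
    choose! g hg using hs
    exact ⟨fun w _ => g (w ∘ Sum.inl) (w ∘ Sum.inr),
      (key fun w => g (w ∘ Sum.inl) (w ∘ Sum.inr)).2 hg⟩

/-- The set chosen for `Q i` may vary with the argument `z` of the row. After this choice the team
is extended by all fresh arguments `z'` and by values depending on `s` and `z'` only, required to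
equal the old values when `z' = z`. The subformula is then evaluated on the rows with `s` extended
by `a`, with `z'`, and with the new values. -/
theorem FlatDef.quant (hQ : ∀ i, (Q i).Mono) (i : ι)
    {A : ∀ M : Type u, L.Structure M → (Fin p → (Fin m → M) → M) → (Fin (n + k) → M) → Prop}
    (hA : FlatDef Q L m p (n + k) A) :
    FlatDef Q L m p n (fun M S f s => {a : Fin k → M | A M S f (Fin.append s a)} ∈ Q i M) := by
  obtain ⟨P, hP, h⟩ := hA
  let V₁ := GraphVar n m p ⊕ Fin k
  let V₂ := V₁ ⊕ Fin m
  let V₃ := V₂ ⊕ Fin p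
  let σ : GraphVar (n + k) m p → V₃ := Sum.elim
    (Fin.append (Sum.inl ∘ Sum.inl ∘ Sum.inl ∘ Sum.inl) (Sum.inl ∘ Sum.inl ∘ Sum.inr))
    (Sum.elim (Sum.inl ∘ Sum.inr) Sum.inr)
  let κ : Fin n ⊕ Fin m → V₂ := Sum.elim (Sum.inl ∘ Sum.inl ∘ Sum.inl) Sum.inr
  have hcopy (i : Fin p) := DDef.flat_imp_varEq (Q := Q) (L := L) (V := V₃)
    (Sum.inl (Sum.inl (Sum.inl (Sum.inr (Sum.inr i))))) (Sum.inr i)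
    (Sum.inl ∘ Sum.inl ∘ Sum.inl ∘ Sum.inr ∘ Sum.inl) (Sum.inl ∘ Sum.inr)
  refine ⟨_, (((hP.comap σ).forallFin_and hcopy).exKey κ).alls.quantify (dQuantifier_quant hQ i),
    fun M _ S X f => ?_⟩
  have hσ (y : V₃ → M) : (y ∘ σ) ∘ Sum.inl = Fin.append
      (y ∘ Sum.inl ∘ Sum.inl ∘ Sum.inl ∘ Sum.inl) (y ∘ Sum.inl ∘ Sum.inl ∘ Sum.inr) :=
    comp_append y _ _
  have hκ (y : V₃ → M) : y ∘ Sum.inl ∘ κ =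
      Sum.elim (y ∘ Sum.inl ∘ Sum.inl ∘ Sum.inl ∘ Sum.inl) (y ∘ Sum.inl ∘ Sum.inr) :=
    Sum.comp_elim (y ∘ Sum.inl) _ _
  constructor
  · rintro ⟨X', hX', g, hg, hPg⟩ s hs
    -- If the empty set is allowed, rows may vanish and the copied values go unchecked, but then
    -- every set belongs to the quantifier.
    by_cases hne : ∅ ∈ Q i M
    · exact hQ i M _ _ (Set.empty_subset _) hne
    let row (z : Fin m → M) (a : Fin k → M) (z' : Fin m → M) : V₃ → M :=
      Sum.elim (Sum.elim (Sum.elim (Sum.elim s (Sum.elim z fun j => f s j z)) a) z')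
        (g (Sum.elim s z'))
    have hrow {z a} (ha : Sum.elim (Sum.elim s (Sum.elim z fun j => f s j z)) a ∈ X') (z') :
        row z a z' ∈ {y : V₃ → M | y ∘ Sum.inl ∈ {y : V₂ → M | y ∘ Sum.inl ∈ X'} ∧
          y ∘ Sum.inr = g (y ∘ Sum.inl ∘ κ)} := by
      refine ⟨ha, ?_⟩
      rw [hκ]
      rfl
    -- The set chosen at the row of `z` is nonempty, so some extended row survives there; comparing
    -- it at `z' = z` fixes the new value. Hence the rebuilt functions are `f s`.
    have hg' (z j) : g (Sum.elim s z) j = f s j z := by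
      have hz := hX' (Sum.elim s (Sum.elim z fun j => f s j z)) ⟨hs, fun _ => rfl⟩
      obtain ⟨a, ha⟩ : {a | Sum.elim (Sum.elim s (Sum.elim z fun j => f s j z)) a ∈ X'}.Nonempty :=
        Set.nonempty_iff_ne_empty.2 fun h => hne (h ▸ hz)
      exact (hg j _ (hrow ha z) rfl).symm
    obtain ⟨z⟩ : Nonempty (Fin m → M) := inferInstance
    -- One arbitrary old row suffices: its chosen set is in the quantifier, and each `a` in it comes
    -- with the full rebuilt graph over all `z'`.
    refine hQ i M _ _ (fun a ha => ?_)
      (hX' (Sum.elim s (Sum.elim z fun j => f s j z)) ⟨hs, fun _ => rfl⟩)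
    -- The graph team of this single assignment is part of the evaluated team, so downward closure
    -- isolates it.
    refine (h M S {Fin.append s a} fun _ => f s).1 (hP.mono ?_ hPg) _ rfl
    rintro x ⟨hx, hf⟩
    refine ⟨_, hrow ha (x ∘ Sum.inr ∘ Sum.inl), funext (Sum.rec (fun j => ?_) (Sum.rec (fun j => rfl)
      fun j => (hg' _ j).trans (hf j).symm))⟩
    exact congrFun ((hσ (row z a _)).trans (Set.mem_singleton_iff.1 hx).symm) j
  · intro hs
    -- Every row of `s` receives the same set, the truth set of the subformula, and the rebuilt
    -- values are those of `f s`.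
    refine ⟨{y | y ∘ Sum.inl ∈ graphTeam X f ∧ A M S (f (y ∘ Sum.inl ∘ Sum.inl))
      (Fin.append (y ∘ Sum.inl ∘ Sum.inl) (y ∘ Sum.inr))},
      fun x hx => hQ i M _ _ (fun a ha => ⟨hx, ha⟩) (hs _ hx.1),
      fun w j => f (w ∘ Sum.inl) j (w ∘ Sum.inr), fun j y hy hz => ?_, ?_⟩
    · refine (hy.1.1.2 j).trans (Eq.trans ?_ (congrFun hy.2 j).symm)
      exact congrArg (f _ j) hz
    · refine hP.mono ?_ ((h M S {s | s ∘ Fin.castAdd k ∈ X ∧ A M S (f (s ∘ Fin.castAdd k)) s}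
        fun s => f (s ∘ Fin.castAdd k)).2 fun s hs => hs.2)
      rintro _ ⟨y, ⟨⟨⟨hX, -⟩, hA⟩, hy⟩, rfl⟩
      refine ⟨?_, fun j => ?_⟩
      · simp only [hσ, Set.mem_ofPred_eq, append_comp_castAdd]
        exact ⟨hX, hA⟩
      · simp only [hσ, append_comp_castAdd]
        exact congrFun hy j

theorem FunFormula.flatDef (hQ : ∀ i, (Q i).Mono) (φ : FunFormula k ι L m p n) :
    FlatDef Q L m p n (fun _ S f s => φ.Sat Q S f s) := by
  induction φ with
  | lit a => exact .lit a
  | nlit a => exact .nlit a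
  | val i c x y => exact .val i c x y
  | and φ ψ ih₁ ih₂ => exact ih₁.and ih₂
  | or φ ψ ih₁ ih₂ => exact ih₁.or ih₂
  | ex φ ih => exact ih.ex
  | all φ ih => exact ih.all
  | quant i φ ih => exact ih.quant hQ i
  | exFun c φ ih => exact ih.exFun c

end FlatDef

end graphTeam

theorem ESOFormula.exists_dFormula {k : ℕ} {ι : Type} {Q : ι → GenQuantifier.{u} k}
    (hQ : ∀ i, (Q i).Mono) {L : FirstOrder.Language.{v, w}} (φ : ESOFormula k ι L 0) :
    ∃ ψ : DFormula k ι L 0, ∀ (M : Type u) [Nonempty M] [L.Structure M],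
      φ.TrueIn Q M ↔ ψ.TrueIn Q M := by
  obtain ⟨m, χ, hχ⟩ := φ.exists_funFormula (Q := Q)
  obtain ⟨P, hP, h⟩ := χ.flatDef hQ
  -- With no individual or function variables, a graph team consists of the argument tuples alone,
  -- so universally quantifying `m` variables over the empty assignment produces it.
  obtain ⟨ψ, hψ⟩ := (hP.comap (V := Empty ⊕ Fin m) (Sum.elim Fin.elim0
    (Sum.elim Sum.inr Fin.elim0))).alls.formula Empty.elim
  refine ⟨ψ, fun M _ S => ?_⟩
  refine Iff.trans ?_ (hψ M S _).symm
  have key : (· ∘ (Sum.elim Fin.elim0 (Sum.elim Sum.inr Fin.elim0) :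
      GraphVar 0 m 0 → Empty ⊕ Fin m)) '' {y : Empty ⊕ Fin m → M |
        y ∘ Sum.inl ∈ (· ∘ (Empty.elim : Empty → Fin 0)) '' {(Fin.elim0 : Fin 0 → M)}} =
      graphTeam {(Fin.elim0 : Fin 0 → M)} (fun _ => Fin.elim0) := by
    ext y
    constructor
    · rintro ⟨y, -, rfl⟩
      exact ⟨Subsingleton.elim _ _, fun i => i.elim0⟩
    · rintro -
      refine ⟨Sum.elim Empty.elim (y ∘ Sum.inr ∘ Sum.inl), ⟨_, rfl, Subsingleton.elim _ _⟩, ?_⟩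
      ext (i | i | i)
      exacts [i.elim0, rfl, i.elim0]
  simp only [key, h, Set.mem_singleton_iff, forall_eq]
  exact hχ M S _ _

end TeamLogic

theorem mainTheorem5 {k : ℕ} (Q : TeamLogic.GenQuantifier.{u} k) (hQ : Q.Mono)
    (L : FirstOrder.Language.{v, w}) :
    (∀ φ : TeamLogic.ESOFormula k (Fin 2) L 0, ∃ ψ : TeamLogic.DFormula k (Fin 2) L 0,
      ∀ (M : Type u) [Nonempty M] [L.Structure M],
        φ.TrueIn ![Q, Q.dual] M ↔ ψ.TrueIn ![Q, Q.dual] M) ∧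
    (∀ ψ : TeamLogic.DFormula k (Fin 2) L 0, ∃ φ : TeamLogic.ESOFormula k (Fin 2) L 0,
      ∀ (M : Type u) [Nonempty M] [L.Structure M],
        ψ.TrueIn ![Q, Q.dual] M ↔ φ.TrueIn ![Q, Q.dual] M) ∧
    (∀ χ : TeamLogic.FOFormula k (Fin 1) L 0, ∃ ψ : TeamLogic.DFormula k (Fin 2) L 0,
      ∀ (M : Type u) [Nonempty M] [L.Structure M],
        χ.TrueIn ![Q] M ↔ ψ.TrueIn ![Q, Q.dual] M) := by
  have hmono : ∀ i, (![Q, Q.dual] i).Mono := by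
    intro i
    fin_cases i
    exacts [hQ, hQ.dual]
  refine ⟨fun φ => φ.exists_dFormula hmono, fun ψ => ?_, fun χ => ?_⟩
  · obtain ⟨φ, hφ⟩ := ψ.exists_esoFormula (Q := ![Q, Q.dual])
    exact ⟨φ, fun M _ _ => hφ M⟩
  · obtain ⟨φ, hφ⟩ := (χ.esoDef Q).1
    obtain ⟨ψ, hψ⟩ := φ.exists_dFormula hmono
    exact ⟨ψ, fun M _ S => (hφ M S _).symm.trans (hψ M)⟩
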